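/- Fix $\alpha>2$, $\beta\in\mathbb{R}$ and points $x_{\mathrm s},x_{\mathrm r},x_{\mathrm d}\in\mathbb{R}^2$ (source, relay, destination; one may take $x_{\mathrm d}=0$). Let $\ell(r)=(1+r^{\alpha})^{-1}$ be the path loss function. For $\lambda>0$ let $\Phi_\lambda$ be a stationary Poisson point process of density $\lambda$ on $\mathbb{R}^2$ (the interferers), and let $$\mathsf I_{\mathrm r}=\sum_{x\in\Phi_\lambda}\ell(|x-x_{\mathrm r}|),\qquad \mathsf I_{\mathrm d}=\sum_{x\in\Phi_\lambda}\ell(|x-x_{\mathrm d}|)$$ be the interference at the relay and at the destination in the path-loss-only model (all fading gains equal to $1$). Let $$\mathsf{SIR}_{\mathrm{sr}}=\frac{\ell(|x_{\mathrm s}-x_{\mathrm r}|)}{\mathsf I_{\mathrm r}},\qquad \mathsf{SIR}_{\mathrm{sd}}=\frac{2\,\ell(|x_{\mathrm s}-x_{\mathrm d}|)}{\mathsf I_{\mathrm d}},\qquad q_{\mathrm{BC}}(\lambda)=\mathbb P\big(\mathsf{SIR}_{\mathrm{sd}}<\beta,\ \mathsf{SIR}_{\mathrm{sr}}<\beta\big),$$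 so that $q_{\mathrm{BC}}$ is the broadcast-phase outage probability of selection decode-and-forward. Suppose that $\beta\,\ell(|x_{\mathrm s}-x_{\mathrm r}|)^{-1}>1$ and $\tfrac12\beta\,\ell(|x_{\mathrm s}-x_{\mathrm d}|)^{-1}>1$, and put $$r_1=\big(\beta\,\ell(|x_{\mathrm s}-x_{\mathrm r}|)^{-1}-1\big)^{1/\alpha}>0,\qquad r_2=\big(\tfrac12\beta\,\ell(|x_{\mathrm s}-x_{\mathrm d}|)^{-1}-1\big)^{1/\alpha}>0.$$ Let $\mathcal A_{\mathrm r}=b(x_{\mathrm r},r_1)$ and $\mathcal A_{\mathrm d}=b(x_{\mathrm d},r_2)$ be the open discs (the locations at which a single interferer alone causes outage at the relay, respectively at the destination), and let $\mathcal A_{\mathrm{r,d}}=\mathcal A_{\mathrm r}\cap\mathcal A_{\mathrm d}$. Write $|A|$ for the area of $A$, and $f(\lambda)\sim g(\lambda)$ if $\lim_{\lambda\to0^+}f(\lambda)/g(\lambda)$ exists and lies in $(0,\infty)$. Then $$q_{\mathrm{BC}}(\lambda)\sim\begin{cases}\lambda\,|\mathcal A_{\mathrm{r,d}}|,&\mathcal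 A_{\mathrm{r,d}}\neq\emptyset,\\ \lambda^2\,|\mathcal A_{\mathrm r}|\,|\mathcal A_{\mathrm d}|,&\mathcal A_{\mathrm{r,d}}=\emptyset,\end{cases}$$ and the spatial-contention diversity order in the broadcast phase, $\Delta=\lim_{\lambda\to0^+}\dfrac{\log q_{\mathrm{BC}}(\lambda)}{\log\lambda}$, exists and equals $$\Delta=\begin{cases}1,&|x_{\mathrm r}-x_{\mathrm d}|<r_1+r_2,\\ 2,&\text{otherwise.}\end{cases}$$ -/

import Mathlib

open MeasureTheory ProbabilityTheory Filter Topology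
open scoped ENNReal

noncomputable section

namespace SpatialContention

/-- The Euclidean plane. -/
abbrev Plane : Type := EuclideanSpace ℝ (Fin 2)

/-- `Φ`, a random locally finite set of points of the plane, is a Poisson point process with
intensity measure `ν`: the number of points in a measurable set of finite intensity is Poisson
distributed with parameter the intensity of that set, and the numbers of points in pairwise
disjoint measurable sets are independent. -/
structure IsPoissonPointProcess {Ω : Type*} [MeasurableSpace Ω] (P : Measure Ω)
    (Φ : Ω → Set Plane) (ν : Measure Plane) : Prop where
  isProbabilityMeasure : IsProbabilityMeasure P
  locallyFinite : ∀ ω, ∀ K : Set Plane, Bornology.IsBounded K → (Φ ω ∩ K).Finite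
  measurable_count : ∀ A : Set Plane, MeasurableSet A →
    Measurable fun ω => (Φ ω ∩ A).encard
  poisson_count : ∀ A : Set Plane, MeasurableSet A → ν A ≠ ∞ → ∀ k : ℕ,
    P {ω | (Φ ω ∩ A).encard = (k : ℕ∞)} = poissonMeasure (ν A).toNNReal {k}
  independent_counts : ∀ (n : ℕ) (A : Fin n → Set Plane), (∀ i, MeasurableSet (A i)) →
    (∀ i j, i ≠ j → Disjoint (A i) (A j)) →
    iIndepFun (fun i ω => (Φ ω ∩ A i).encard) P

/-- The stationary Poisson point process of density `l` (points per unit area). -/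
def IsStationaryPPP {Ω : Type*} [MeasurableSpace Ω] (P : Measure Ω)
    (Φ : Ω → Set Plane) (l : ℝ) : Prop :=
  IsPoissonPointProcess P Φ (ENNReal.ofReal l • volume)

/-- The non-singular path loss function `ℓ(r) = 1 / (1 + r ^ α)`. -/
def pathLoss (α r : ℝ) : ℝ := (1 + r ^ α)⁻¹

/-- Interference received at `z` from interferers located at the points of `φ`, with unit transmit
power and without fading. The value is a sum of nonnegative terms, possibly infinite. -/
def interference (α : ℝ) (φ : Set Plane) (z : Plane) : ℝ≥0∞ :=
  ∑' x : φ, ENNReal.ofReal (pathLoss α ‖(x : Plane) - z‖)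

/-- Signal-to-interference ratio at the relay. -/
def sirSR (α : ℝ) (xs xr : Plane) (φ : Set Plane) : ℝ≥0∞ :=
  ENNReal.ofReal (pathLoss α ‖xs - xr‖) / interference α φ xr

/-- Signal-to-interference ratio at the destination after combining the two transmissions of the
source (the relay has failed to decode, so the source transmits twice). -/
def sirSD (α : ℝ) (xs xd : Plane) (φ : Set Plane) : ℝ≥0∞ :=
  ENNReal.ofReal (2 * pathLoss α ‖xs - xd‖) / interference α φ xd

/-- The broadcast-phase outage probability of selection decode-and-forward with decoding
threshold `β`. -/
def qBC {Ω : Type*} [MeasurableSpace Ω] (P : Measure Ω) (Φ : Ω → Set Plane)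
    (α β : ℝ) (xs xr xd : Plane) : ℝ :=
  P.real {ω | sirSD α xs xd (Φ ω) < ENNReal.ofReal β ∧ sirSR α xs xr (Φ ω) < ENNReal.ofReal β}

/-- Radius of the disc around the relay in which a single interferer causes outage. -/
def radiusR (α β : ℝ) (xs xr : Plane) : ℝ :=
  (β * (pathLoss α ‖xs - xr‖)⁻¹ - 1) ^ (1 / α)

/-- Radius of the disc around the destination in which a single interferer causes outage. -/
def radiusD (α β : ℝ) (xs xd : Plane) : ℝ :=
  (1 / 2 * β * (pathLoss α ‖xs - xd‖)⁻¹ - 1) ^ (1 / α)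

/-- `f` and `g` scale alike at `0+`: the quotient `f / g` has a limit in `(0, ∞)`. -/
def ScalesLike (f g : ℝ → ℝ) : Prop :=
  ∃ c : ℝ, 0 < c ∧ Tendsto (fun l => f l / g l) (𝓝[>] 0) (𝓝 c)

/-- The outage probability `q`, as a function of the interferer density, has spatial-contention
diversity order `Δ`. -/
def HasSCDO (q : ℝ → ℝ) (Δ : ℝ) : Prop :=
  Tendsto (fun l => Real.log (q l) / Real.log l) (𝓝[>] 0) (𝓝 Δ)

end SpatialContention

end

noncomputable section

namespace SpatialContention

/-! Outage at both receivers says that two shot noises exceed thresholds: with `f`, `g` the powers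
received at the relay and the destination, `s = ℓ(r₁)` and `t = ℓ(r₂)`, the event is `s < ∑ f` and
`t < ∑ g`. As `ℓ` is strictly decreasing, a single point causes it exactly when it lies in both
discs. At low density the event is caused by the fewest points able to cause it.

If the discs meet, one point suffices and the probability is `l * |Ar ∩ Ad|` to first order
(`tendsto_measure_exceedance_div`). The lower bound compares a count with its next factorial moment.
The upper bound discards two points in a large ball and a noticeable far field.

If the discs are disjoint, the order is `l ^ 2`, with constant half the volume of the pairs that
jointly exceed (`tendsto_measure_exceedance_div_sq`). The danger is a point just outside a disc,
helped by a weak far field that only has to supply the deficit `δ`. Markov's inequality gives `l /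
δ`, and `1 / δ` is not integrable across the circle, where `δ` vanishes linearly. Taking `p`-th
powers first, with `2 / α < p < 1`, gives `l * δ ^ (-p)`, which is integrable there, while `ℓ ^ p`
remains integrable over the plane. The result is an integrable pair kernel whose sum is at least 1
on the event (`one_le_tsum_pairKernel`). The second factorial moment measure
(`lintegral_lintegral_offDiag`) then makes pairs far from the origin negligible. -/

/-- The counting measure of a set of points, as a sum of Dirac masses. -/
def pointMeasure {E : Type*} [MeasurableSpace E] (φ : Set E) : Measure E :=
  Measure.sum fun x : φ => Measure.dirac (x : E)

lemma encard_offDiag_of_finite {α : Type*} {φ : Set α} (h : φ.Finite) :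
    φ.offDiag.encard = (φ.ncard.descFactorial 2 : ℕ) := by
  classical
  obtain ⟨s, rfl⟩ := h.exists_finset_coe
  rw [← Finset.coe_offDiag, Set.encard_coe_eq_coe_finsetCard, Set.ncard_coe_finset,
    Finset.offDiag_card]
  congr 1
  simp [Nat.descFactorial, Nat.mul_sub, mul_comm]

/-! ### Counting measures of configurations and of their ordered pairs -/

section PointMeasure

variable {E : Type*} [MeasurableSpace E]

lemma lintegral_pointMeasure [MeasurableSingletonClass E] (φ : Set E) (f : E → ℝ≥0∞) :
    ∫⁻ x, f x ∂pointMeasure φ = ∑' x : φ, f x := by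
  simp [pointMeasure, lintegral_sum_measure, lintegral_dirac]

lemma pointMeasure_apply (φ : Set E) {A : Set E} (hA : MeasurableSet A) :
    pointMeasure φ A = ((φ ∩ A).encard : ℝ≥0∞) := by
  rw [pointMeasure, Measure.sum_apply _ hA, ← ENNReal.tsum_set_one,
    tsum_subtype (φ ∩ A) fun _ => (1 : ℝ≥0∞)]
  simp_rw [Measure.dirac_apply' _ hA]
  rw [tsum_subtype φ (A.indicator 1), Set.indicator_indicator]
  rfl

lemma pointMeasure_offDiag_prod_of_disjoint (φ : Set E) {A B : Set E} (hA : MeasurableSet A)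
    (hB : MeasurableSet B) (h : Disjoint A B) :
    pointMeasure φ.offDiag (A ×ˢ B) = pointMeasure φ A * pointMeasure φ B := by
  have : φ.offDiag ∩ (A ×ˢ B) = (φ ∩ A) ×ˢ (φ ∩ B) := by
    ext ⟨x, y⟩
    simp only [Set.mem_inter_iff, Set.mem_offDiag, Set.mem_prod]
    refine ⟨fun h => ⟨⟨h.1.1, h.2.1⟩, h.1.2.1, h.2.2⟩, fun h' =>
      ⟨⟨h'.1.1, h'.2.1, ?_⟩, h'.1.2, h'.2.2⟩⟩
    exact fun hxy => Set.disjoint_left.1 h h'.1.2 (hxy ▸ h'.2.2)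
  rw [pointMeasure_apply _ (hA.prod hB), this, Set.encard_prod, pointMeasure_apply _ hA,
    pointMeasure_apply _ hB, ENat.toENNReal_mul]

lemma pointMeasure_offDiag_prod_self (φ : Set E) {C : Set E} (hC : MeasurableSet C)
    (h : (φ ∩ C).Finite) :
    pointMeasure φ.offDiag (C ×ˢ C) = ((φ ∩ C).ncard.descFactorial 2 : ℕ) := by
  have : φ.offDiag ∩ (C ×ˢ C) = (φ ∩ C).offDiag := by
    ext ⟨x, y⟩
    simp only [Set.mem_inter_iff, Set.mem_offDiag, Set.mem_prod]
    tauto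
  rw [pointMeasure_apply _ (hC.prod hC), this, encard_offDiag_of_finite h]
  simp

/-- Each piece is a rectangle with disjoint sides or a square. For these the number of ordered pairs
of distinct points is a function of plain counts. -/
lemma measure_prod_decomp (m : Measure (E × E)) {A B : Set E} (hA : MeasurableSet A)
    (hB : MeasurableSet B) :
    m (A ×ˢ B) = m ((A \ B) ×ˢ B) + m ((A ∩ B) ×ˢ (B \ A)) + m ((A ∩ B) ×ˢ (A ∩ B)) := by
  rw [add_assoc, ← measure_union, ← measure_union]
  · congr 1
    ext ⟨x, y⟩
    simp only [Set.mem_union, Set.mem_prod, Set.mem_sdiff, Set.mem_inter_iff]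
    tauto
  · refine Set.disjoint_left.2 ?_
    rintro ⟨x, y⟩
    simp only [Set.mem_union, Set.mem_prod, Set.mem_sdiff, Set.mem_inter_iff]
    tauto
  · exact ((hA.inter hB).prod (hB.diff hA)).union ((hA.inter hB).prod (hA.inter hB))
  · refine Set.disjoint_left.2 ?_
    rintro ⟨x, y⟩
    simp only [Set.mem_prod, Set.mem_sdiff, Set.mem_inter_iff]
    tauto
  · exact (hA.inter hB).prod (hA.inter hB)

end PointMeasure

/-! ### Factorial moments and moment measures of the Poisson process -/

lemma tsum_descFactorial_mul_poissonMeasure (r : NNReal) (m : ℕ) :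
    ∑' k : ℕ, ((k.descFactorial m : ℕ) : ℝ≥0∞) * poissonMeasure r {k} = (r : ℝ≥0∞) ^ m := by
  -- The terms with `k < m` vanish. After the shift by `m` the falling factorial cancels against `(k
  -- + m)!`, leaving the total Poisson mass times `r ^ m`.
  rw [← Summable.sum_add_tsum_nat_add' (k := m) ENNReal.summable, Finset.sum_eq_zero, zero_add]
  · have key : ∀ k : ℕ, (((k + m).descFactorial m : ℕ) : ℝ≥0∞) * poissonMeasure r {k + m} =
        (r : ℝ≥0∞) ^ m * poissonMeasure r {k} := by
      intro k
      have h1 : (((k + m).descFactorial m : ℕ) : ℝ≥0∞) =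
          ENNReal.ofReal ((k + m).descFactorial m : ℕ) := by simp
      have h2 : (r : ℝ≥0∞) ^ m = ENNReal.ofReal ((r : ℝ) ^ m) := by
        rw [ENNReal.ofReal_pow r.coe_nonneg, ENNReal.ofReal_coe_nnreal]
      rw [poissonMeasure_singleton, poissonMeasure_singleton, h1, h2,
        ← ENNReal.ofReal_mul (by positivity), ← ENNReal.ofReal_mul (by positivity)]
      congr 1
      have h3 := Nat.factorial_mul_descFactorial (Nat.le_add_left m k)
      rw [Nat.add_sub_cancel] at h3
      rw [← h3, pow_add]
      have h4 : ((k + m).descFactorial m : ℝ) ≠ 0 := by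
        rw [Nat.cast_ne_zero]
        exact (Nat.descFactorial_pos.2 (Nat.le_add_left m k)).ne'
      push_cast
      field_simp
    simp_rw [key]
    rw [ENNReal.tsum_mul_left]
    have : ∑' k : ℕ, poissonMeasure r {k} = 1 := by
      have := lintegral_countable' (μ := poissonMeasure r) (fun _ => 1)
      simpa using this.symm
    rw [this, mul_one]
  · intro k hk
    rw [Nat.descFactorial_of_lt (Finset.mem_range.1 hk)]
    simp

namespace IsPoissonPointProcess

variable {Ω : Type*} [MeasurableSpace Ω] {P : Measure Ω} {Φ : Ω → Set Plane} {ν : Measure Plane}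

lemma measurable_pointMeasure_apply (h : IsPoissonPointProcess P Φ ν) {A : Set Plane}
    (hA : MeasurableSet A) : Measurable fun ω => pointMeasure (Φ ω) A := by
  simp_rw [pointMeasure_apply _ hA]
  exact (Measurable.of_discrete (f := ENat.toENNReal)).comp (h.measurable_count A hA)

lemma measurable_pointMeasure (h : IsPoissonPointProcess P Φ ν) :
    Measurable fun ω => pointMeasure (Φ ω) :=
  Measure.measurable_of_measurable_coe _ fun _ hA => h.measurable_pointMeasure_apply hA

lemma measurable_ncard (h : IsPoissonPointProcess P Φ ν) {A : Set Plane}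
    (hA : MeasurableSet A) : Measurable fun ω => (Φ ω ∩ A).ncard :=
  (Measurable.of_discrete (f := ENat.toNat)).comp (h.measurable_count A hA)

lemma pointMeasure_apply_eq_ncard (h : IsPoissonPointProcess P Φ ν) {A : Set Plane}
    (hA : MeasurableSet A) (hb : Bornology.IsBounded A) (ω : Ω) :
    pointMeasure (Φ ω) A = ((Φ ω ∩ A).ncard : ℝ≥0∞) := by
  rw [pointMeasure_apply _ hA, ← (h.locallyFinite ω A hb).cast_ncard_eq]
  simp

lemma lintegral_descFactorial (h : IsPoissonPointProcess P Φ ν) [IsLocallyFiniteMeasure ν]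
    {A : Set Plane} (hA : MeasurableSet A) (hb : Bornology.IsBounded A) (m : ℕ) :
    ∫⁻ ω, (((Φ ω ∩ A).ncard.descFactorial m : ℕ) : ℝ≥0∞) ∂P = ν A ^ m := by
  have hν : ν A ≠ ∞ := hb.measure_lt_top.ne
  have h1 : ∫⁻ ω, (((Φ ω ∩ A).ncard.descFactorial m : ℕ) : ℝ≥0∞) ∂P =
      ∫⁻ k : ℕ, ((k.descFactorial m : ℕ) : ℝ≥0∞) ∂(P.map fun ω => (Φ ω ∩ A).ncard) := by
    rw [lintegral_map .of_discrete (h.measurable_ncard hA)]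
  rw [h1, lintegral_countable']
  have h2 : ∀ k : ℕ, (P.map fun ω => (Φ ω ∩ A).ncard) {k} =
      poissonMeasure (ν A).toNNReal {k} := by
    intro k
    rw [Measure.map_apply (h.measurable_ncard hA) (measurableSet_singleton k),
      ← h.poisson_count A hA hν k]
    congr 1
    ext ω
    simp only [Set.mem_preimage, Set.mem_singleton_iff, Set.mem_ofPred_eq]
    rw [← (h.locallyFinite ω A hb).cast_ncard_eq]
    simp
  simp_rw [h2]
  rw [tsum_descFactorial_mul_poissonMeasure, ENNReal.coe_toNNReal hν]

lemma lintegral_pointMeasure_apply_of_isBounded (h : IsPoissonPointProcess P Φ ν)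
    [IsLocallyFiniteMeasure ν] {A : Set Plane} (hA : MeasurableSet A)
    (hb : Bornology.IsBounded A) : ∫⁻ ω, pointMeasure (Φ ω) A ∂P = ν A := by
  simp_rw [h.pointMeasure_apply_eq_ncard hA hb]
  simpa using h.lintegral_descFactorial hA hb 1

/-- **Campbell's formula**. -/
theorem lintegral_lintegral (h : IsPoissonPointProcess P Φ ν) [IsLocallyFiniteMeasure ν]
    {f : Plane → ℝ≥0∞} (hf : Measurable f) :
    ∫⁻ ω, ∫⁻ x, f x ∂pointMeasure (Φ ω) ∂P = ∫⁻ x, f x ∂ν := by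
  have hm := h.measurable_pointMeasure
  rw [← Measure.lintegral_bind hm.aemeasurable hf.aemeasurable]
  congr 1
  refine (Measure.ext_iff_of_iUnion_eq_univ (Metric.iUnion_closedBall_nat (0 : Plane))).2 fun n => ?_
  ext A hA
  have hAn : MeasurableSet (A ∩ Metric.closedBall (0 : Plane) n) :=
    hA.inter measurableSet_closedBall
  rw [Measure.restrict_apply hA, Measure.restrict_apply hA,
    Measure.bind_apply hAn hm.aemeasurable]
  exact h.lintegral_pointMeasure_apply_of_isBounded hAn
    (Metric.isBounded_closedBall.subset Set.inter_subset_right)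

lemma pointMeasure_offDiag_prod_eq (h : IsPoissonPointProcess P Φ ν) {A B : Set Plane}
    (hA : MeasurableSet A) (hB : MeasurableSet B) (hbA : Bornology.IsBounded A) (ω : Ω) :
    pointMeasure (Φ ω).offDiag (A ×ˢ B) =
      pointMeasure (Φ ω) (A \ B) * pointMeasure (Φ ω) B +
      pointMeasure (Φ ω) (A ∩ B) * pointMeasure (Φ ω) (B \ A) +
      ((Φ ω ∩ (A ∩ B)).ncard.descFactorial 2 : ℕ) := by
  rw [measure_prod_decomp _ hA hB,
    pointMeasure_offDiag_prod_of_disjoint _ (hA.diff hB) hB Set.disjoint_sdiff_left,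
    pointMeasure_offDiag_prod_of_disjoint _ (hA.inter hB) (hB.diff hA)
      (Set.disjoint_sdiff_right.mono_left Set.inter_subset_left),
    pointMeasure_offDiag_prod_self _ (hA.inter hB)
      (h.locallyFinite ω _ (hbA.subset Set.inter_subset_left))]

lemma measurable_pointMeasure_offDiag_prod (h : IsPoissonPointProcess P Φ ν) {A B : Set Plane}
    (hA : MeasurableSet A) (hB : MeasurableSet B) (hbA : Bornology.IsBounded A) :
    Measurable fun ω => pointMeasure (Φ ω).offDiag (A ×ˢ B) := by
  simp_rw [h.pointMeasure_offDiag_prod_eq hA hB hbA]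
  have hd : Measurable fun ω => (((Φ ω ∩ (A ∩ B)).ncard.descFactorial 2 : ℕ) : ℝ≥0∞) :=
    (Measurable.of_discrete (f := fun k : ℕ => ((k.descFactorial 2 : ℕ) : ℝ≥0∞))).comp
      (h.measurable_ncard (hA.inter hB))
  exact (((h.measurable_pointMeasure_apply (hA.diff hB)).mul
    (h.measurable_pointMeasure_apply hB)).add
    ((h.measurable_pointMeasure_apply (hA.inter hB)).mul
    (h.measurable_pointMeasure_apply (hB.diff hA)))).add hd

/-- The π-system argument on rectangles needs finite measures, so it is run on the squares `B n ×ˢ B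
n`; local finiteness makes the restrictions finite, and the whole is their supremum. -/
lemma measurable_pointMeasure_offDiag (h : IsPoissonPointProcess P Φ ν) :
    Measurable fun ω => pointMeasure (Φ ω).offDiag := by
  set B : ℕ → Set Plane := fun n => Metric.closedBall 0 n
  have hB : ∀ n, MeasurableSet (B n) := fun n => measurableSet_closedBall
  have hBb : ∀ n, Bornology.IsBounded (B n) := fun n => Metric.isBounded_closedBall
  have hrestr : ∀ n, Measurable fun ω => (pointMeasure (Φ ω).offDiag).restrict (B n ×ˢ B n) := by
    intro n
    have : ∀ ω, IsFiniteMeasure ((pointMeasure (Φ ω).offDiag).restrict (B n ×ˢ B n)) := by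
      intro ω
      refine ⟨?_⟩
      rw [Measure.restrict_apply MeasurableSet.univ, Set.univ_inter,
        pointMeasure_offDiag_prod_self _ (hB n) (h.locallyFinite ω _ (hBb n))]
      exact ENNReal.natCast_lt_top _
    refine Measurable.measure_of_isPiSystem generateFrom_prod.symm isPiSystem_prod ?_ ?_
    · rintro _ ⟨A, hA, A', hA', rfl⟩
      replace hA : MeasurableSet A := hA
      replace hA' : MeasurableSet A' := hA'
      simp_rw [Measure.restrict_apply (hA.prod hA'), Set.prod_inter_prod]
      exact h.measurable_pointMeasure_offDiag_prod (hA.inter (hB n)) (hA'.inter (hB n))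
        ((hBb n).subset Set.inter_subset_right)
    · simp_rw [Measure.restrict_apply MeasurableSet.univ, Set.univ_inter]
      exact h.measurable_pointMeasure_offDiag_prod (hB n) (hB n) (hBb n)
  refine Measure.measurable_of_measurable_coe _ fun S hS => ?_
  have hS' : ∀ ω, pointMeasure (Φ ω).offDiag S =
      ⨆ n, (pointMeasure (Φ ω).offDiag).restrict (B n ×ˢ B n) S := by
    intro ω
    simp_rw [Measure.restrict_apply hS]
    rw [← Monotone.measure_iUnion]
    · congr 1
      rw [← Set.inter_iUnion, Set.iUnion_prod_of_monotone, Metric.iUnion_closedBall_nat,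
        Set.univ_prod_univ, Set.inter_univ] <;>
      exact fun a b hab => Metric.closedBall_subset_closedBall (by exact_mod_cast hab)
    · intro a b hab
      have : B a ⊆ B b := Metric.closedBall_subset_closedBall (by exact_mod_cast hab)
      exact Set.inter_subset_inter_right _ (Set.prod_mono this this)
  simp_rw [hS']
  exact Measurable.iSup fun n => (Measure.measurable_coe hS).comp (hrestr n)

lemma lintegral_mul_of_disjoint (h : IsPoissonPointProcess P Φ ν)
    [IsLocallyFiniteMeasure ν] {A B : Set Plane} (hA : MeasurableSet A) (hB : MeasurableSet B)
    (hbA : Bornology.IsBounded A) (hbB : Bornology.IsBounded B) (hAB : Disjoint A B) :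
    ∫⁻ ω, pointMeasure (Φ ω) A * pointMeasure (Φ ω) B ∂P = ν A * ν B := by
  have hind : IndepFun (fun ω => pointMeasure (Φ ω) A) (fun ω => pointMeasure (Φ ω) B) P := by
    have h1 := h.independent_counts 2 ![A, B] (by intro i; fin_cases i <;> simpa) (by
      intro i j hij
      fin_cases i <;> fin_cases j <;> simp_all [hAB.symm])
    have h2 : IndepFun (fun ω => (Φ ω ∩ A).encard) (fun ω => (Φ ω ∩ B).encard) P :=
      h1.indepFun (i := 0) (j := 1) (by decide)
    simp_rw [pointMeasure_apply _ hA, pointMeasure_apply _ hB]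
    exact h2.comp (φ := ENat.toENNReal) (ψ := ENat.toENNReal) .of_discrete .of_discrete
  rw [← h.lintegral_pointMeasure_apply_of_isBounded hA hbA,
    ← h.lintegral_pointMeasure_apply_of_isBounded hB hbB]
  exact lintegral_mul_eq_lintegral_mul_lintegral_of_indepFun
    (h.measurable_pointMeasure_apply hA) (h.measurable_pointMeasure_apply hB) hind

/-- Independence handles the two rectangles with disjoint sides. On the square, the second factorial
moment of a Poisson count is the square of its mean, so the three terms recombine into a product. -/
lemma lintegral_pointMeasure_offDiag_prod (h : IsPoissonPointProcess P Φ ν)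
    [IsLocallyFiniteMeasure ν] {A B : Set Plane} (hA : MeasurableSet A) (hB : MeasurableSet B)
    (hbA : Bornology.IsBounded A) (hbB : Bornology.IsBounded B) :
    ∫⁻ ω, pointMeasure (Φ ω).offDiag (A ×ˢ B) ∂P = ν A * ν B := by
  simp_rw [h.pointMeasure_offDiag_prod_eq hA hB hbA]
  have m1 := h.measurable_pointMeasure_apply (hA.diff hB)
  have m2 := h.measurable_pointMeasure_apply hB
  have m3 := h.measurable_pointMeasure_apply (hA.inter hB)
  have m4 := h.measurable_pointMeasure_apply (hB.diff hA)
  have hb1 := hbA.subset (Set.inter_subset_left (s := A) (t := B))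
  have m12 : Measurable fun ω => pointMeasure (Φ ω) (A \ B) * pointMeasure (Φ ω) B := m1.mul m2
  have m34 : Measurable fun ω => pointMeasure (Φ ω) (A ∩ B) * pointMeasure (Φ ω) (B \ A) :=
    m3.mul m4
  have m1234 : Measurable fun ω => pointMeasure (Φ ω) (A \ B) * pointMeasure (Φ ω) B +
      pointMeasure (Φ ω) (A ∩ B) * pointMeasure (Φ ω) (B \ A) := m12.add m34
  rw [lintegral_add_left m1234, lintegral_add_left m12,
    h.lintegral_mul_of_disjoint (hA.diff hB) hB (hbA.subset Set.sdiff_subset) hbB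
      Set.disjoint_sdiff_left,
    h.lintegral_mul_of_disjoint (hA.inter hB) (hB.diff hA) hb1 (hbB.subset Set.sdiff_subset)
      (Set.disjoint_sdiff_right.mono_left Set.inter_subset_left),
    h.lintegral_descFactorial (hA.inter hB) hb1, sq]
  have e1 : ν A = ν (A \ B) + ν (A ∩ B) := by
    rw [add_comm]; exact (measure_inter_add_sdiff A hB).symm
  have e2 : ν B = ν (B \ A) + ν (A ∩ B) := by
    rw [add_comm, Set.inter_comm]; exact (measure_inter_add_sdiff B hA).symm
  rw [e1, add_mul, add_assoc, ← mul_add, ← e2]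

/-- The second factorial moment measure of a Poisson process is the product of its intensity
measure with itself. -/
theorem lintegral_lintegral_offDiag (h : IsPoissonPointProcess P Φ ν) [IsLocallyFiniteMeasure ν]
    {f : Plane × Plane → ℝ≥0∞} (hf : Measurable f) :
    ∫⁻ ω, ∫⁻ p, f p ∂pointMeasure (Φ ω).offDiag ∂P = ∫⁻ p, f p ∂(ν.prod ν) := by
  have hm := h.measurable_pointMeasure_offDiag
  rw [← Measure.lintegral_bind hm.aemeasurable hf.aemeasurable]
  congr 1
  have hU : ⋃ n : ℕ, Metric.closedBall (0 : Plane) n ×ˢ Metric.closedBall (0 : Plane) n =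
      Set.univ := by
    rw [Set.iUnion_prod_of_monotone, Metric.iUnion_closedBall_nat, Set.univ_prod_univ] <;>
    exact fun a b hab => Metric.closedBall_subset_closedBall (by exact_mod_cast hab)
  refine (Measure.ext_iff_of_iUnion_eq_univ hU).2 fun n => ?_
  rw [← Measure.prod_restrict]
  refine (Measure.prod_eq fun A A' hA hA' => ?_).symm
  have hAn := hA.inter (measurableSet_closedBall (x := (0 : Plane)) (ε := n))
  have hAn' := hA'.inter (measurableSet_closedBall (x := (0 : Plane)) (ε := n))
  rw [Measure.restrict_apply hA, Measure.restrict_apply hA', Measure.restrict_apply (hA.prod hA'),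
    Set.prod_inter_prod, Measure.bind_apply (hAn.prod hAn') hm.aemeasurable]
  exact h.lintegral_pointMeasure_offDiag_prod hAn hAn'
    (Metric.isBounded_closedBall.subset Set.inter_subset_right)
    (Metric.isBounded_closedBall.subset Set.inter_subset_right)

/-- The falling factorial of order `m` is at least 1 once there are `m` points, so Markov's
inequality applies to its mean. -/
lemma measure_le_ncard_le (h : IsPoissonPointProcess P Φ ν) [IsLocallyFiniteMeasure ν]
    {A : Set Plane} (hA : MeasurableSet A) (hb : Bornology.IsBounded A) (m : ℕ) :
    P {ω | m ≤ (Φ ω ∩ A).ncard} ≤ ν A ^ m := by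
  rw [← h.lintegral_descFactorial hA hb m]
  have hd : Measurable fun ω => (((Φ ω ∩ A).ncard.descFactorial m : ℕ) : ℝ≥0∞) :=
    (Measurable.of_discrete (f := fun k : ℕ => ((k.descFactorial m : ℕ) : ℝ≥0∞))).comp
      (h.measurable_ncard hA)
  refine le_trans (measure_mono fun ω hω => ?_)
    ((one_mul _).symm.le.trans (mul_meas_ge_le_lintegral hd 1))
  have : 1 ≤ (Φ ω ∩ A).ncard.descFactorial m := Nat.descFactorial_pos.2 hω
  exact_mod_cast this

end IsPoissonPointProcess

/-! ### Passing to the limit of vanishing density -/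

section Limits

/-- Continuity from above of the finite measure with density `h`. -/
lemma tendsto_setLIntegral_of_antitone {E : Type*} [MeasurableSpace E] {μ : Measure E}
    {h : E → ℝ≥0∞} (hh : ∫⁻ x, h x ∂μ ≠ ∞) {T : ℕ → Set E} (hT : ∀ n, MeasurableSet (T n))
    (hanti : Antitone T) (hempty : ⋂ n, T n = ∅) :
    Tendsto (fun n => ∫⁻ x in T n, h x ∂μ) atTop (𝓝 0) := by
  have h1 := tendsto_measure_iInter_atTop (μ := μ.withDensity h)
    (fun n => (hT n).nullMeasurableSet) hanti
    ⟨0, by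
      rw [withDensity_apply _ (hT 0)]
      exact ((setLIntegral_le_lintegral _ _).trans_lt hh.lt_top).ne⟩
  rw [hempty, measure_empty] at h1
  simpa only [Function.comp_def, withDensity_apply _ (hT _)] using h1

lemma tendsto_ofReal_mul_nhdsGT {b : ℝ≥0∞} (hb : b ≠ ∞) :
    Tendsto (fun l : ℝ => ENNReal.ofReal l * b) (𝓝[>] 0) (𝓝 0) := by
  have h1 : Tendsto (fun l : ℝ => ENNReal.ofReal l) (𝓝[>] 0) (𝓝 0) := by
    have := (ENNReal.continuous_ofReal.tendsto 0).mono_left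
      (nhdsWithin_le_nhds (s := Set.Ioi (0 : ℝ)))
    simpa using this
  simpa using ENNReal.Tendsto.mul_const h1 (Or.inr hb)

lemma limsup_div_ofReal_pow_le {Q : ℝ → ℝ≥0∞} {a b : ℝ≥0∞} (k : ℕ) (hb : b ≠ ∞)
    (h : ∀ l : ℝ, 0 < l →
      Q l ≤ ENNReal.ofReal l ^ k * a + ENNReal.ofReal l ^ (k + 1) * b) :
    limsup (fun l => Q l / ENNReal.ofReal l ^ k) (𝓝[>] 0) ≤ a := by
  have h1 : Tendsto (fun l : ℝ => a + ENNReal.ofReal l * b) (𝓝[>] 0) (𝓝 a) := by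
    simpa using (tendsto_const_nhds (x := a)).add (tendsto_ofReal_mul_nhdsGT hb)
  rw [← h1.limsup_eq]
  refine limsup_le_limsup ?_
  filter_upwards [self_mem_nhdsWithin] with l hl
  refine ENNReal.div_le_of_le_mul ((h l hl).trans (le_of_eq ?_))
  ring

lemma le_liminf_div_ofReal_pow {Q : ℝ → ℝ≥0∞} {a b : ℝ≥0∞} (k : ℕ) (hb : b ≠ ∞)
    (h : ∀ l : ℝ, 0 < l →
      ENNReal.ofReal l ^ k * a ≤ Q l + ENNReal.ofReal l ^ (k + 1) * b) :
    a ≤ liminf (fun l => Q l / ENNReal.ofReal l ^ k) (𝓝[>] 0) := by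
  have h1 : Tendsto (fun l : ℝ => a - ENNReal.ofReal l * b) (𝓝[>] 0) (𝓝 a) := by
    simpa using ENNReal.Tendsto.sub (tendsto_const_nhds (x := a)) (tendsto_ofReal_mul_nhdsGT hb)
      (Or.inr ENNReal.zero_ne_top)
  rw [← h1.liminf_eq]
  refine liminf_le_liminf ?_
  filter_upwards [self_mem_nhdsWithin] with l hl
  have hl0 : ENNReal.ofReal l ^ k ≠ 0 := pow_ne_zero _ (ENNReal.ofReal_pos.2 hl).ne'
  have hlt : ENNReal.ofReal l ^ k ≠ ∞ := ENNReal.pow_ne_top ENNReal.ofReal_ne_top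
  rw [tsub_le_iff_right]
  have h2 := h l hl
  have h3 : Q l + ENNReal.ofReal l ^ (k + 1) * b =
      ENNReal.ofReal l ^ k * (Q l / ENNReal.ofReal l ^ k + ENNReal.ofReal l * b) := by
    rw [mul_add, ENNReal.mul_div_cancel hl0 hlt]
    ring
  rw [h3] at h2
  exact (ENNReal.mul_le_mul_iff_right hl0 hlt).1 h2

end Limits

/-! ### Splitting sums over a fixed configuration -/

section Deterministic

lemma tsum_indicator_one {E : Type*} (φ A : Set E) :
    ∑' x : φ, A.indicator (fun _ => (1 : ℝ≥0∞)) x = (φ ∩ A).encard := by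
  rw [tsum_subtype φ (A.indicator _), Set.indicator_indicator, ← tsum_subtype,
    ENNReal.tsum_set_one]

lemma tsum_eq_finset_sum_add_tsum_indicator {E : Type*} (φ C : Set E) (F : Finset E)
    (hF : (F : Set E) = φ ∩ C) (f : E → ℝ≥0∞) :
    ∑' x : φ, f x = ∑ x ∈ F, f x + ∑' x : φ, Cᶜ.indicator f x := by
  rw [tsum_subtype φ f, tsum_subtype φ (Cᶜ.indicator f), ← Finset.tsum_subtype' F f,
    tsum_subtype (F : Set E) f, ← ENNReal.tsum_add]
  congr 1
  ext x
  rw [hF]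
  by_cases hx : x ∈ φ <;> by_cases hC : x ∈ C <;> simp [hx, hC]

/-- A sum over far points becomes part of a sum over pairs by using a fixed near point as first
coordinate. A far-field event then costs a second moment, hence order `l ^ 2`. -/
lemma tsum_indicator_le_tsum_offDiag {E : Type*} {φ C : Set E} {x : E} (hx : x ∈ φ) (hxC : x ∈ C)
    (h : E → ℝ≥0∞) (F : E × E → ℝ≥0∞) (hF : ∀ y ∈ Cᶜ, h y ≤ F (x, y)) :
    ∑' y : φ, Cᶜ.indicator h y ≤ ∑' p : φ.offDiag, F p := by
  rw [tsum_subtype φ (Cᶜ.indicator h), Set.indicator_indicator, ← tsum_subtype]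
  have hne : ∀ y : ↑(φ ∩ Cᶜ), (x, (y : E)) ∈ φ.offDiag := fun y =>
    ⟨hx, y.2.1, fun hxy => y.2.2 (Set.mem_of_eq_of_mem hxy.symm hxC)⟩
  refine (ENNReal.tsum_le_tsum fun y : ↑(φ ∩ Cᶜ) => hF y y.2.2).trans ?_
  exact ENNReal.tsum_comp_le_tsum_of_injective
    (f := fun y : ↑(φ ∩ Cᶜ) => (⟨(x, y), hne y⟩ : φ.offDiag))
    (fun a b hab => Subtype.ext (by simpa using hab)) (fun p => F p)

/-- The configurations whose aggregate signals exceed the thresholds `s` and `t`. -/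
def exceedance (f g : Plane → ℝ≥0∞) (s t : ℝ≥0∞) : Set (Set Plane) :=
  {φ | s < ∑' x : φ, f x ∧ t < ∑' x : φ, g x}

end Deterministic

instance (l : ℝ) : IsLocallyFiniteMeasure (ENNReal.ofReal l • (volume : Measure Plane)) :=
  inferInstanceAs (IsLocallyFiniteMeasure (Real.toNNReal l • (volume : Measure Plane)))

/-! ### Bounds on the exceedance probability at fixed density -/

namespace IsStationaryPPP

variable {Ω : Type*} [MeasurableSpace Ω] {P : Measure Ω} {Φ : Ω → Set Plane} {l : ℝ}

lemma lintegral_tsum (h : IsStationaryPPP P Φ l) {f : Plane → ℝ≥0∞} (hf : Measurable f) :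
    ∫⁻ ω, ∑' x : Φ ω, f x ∂P = ENNReal.ofReal l * ∫⁻ x, f x := by
  have := IsPoissonPointProcess.lintegral_lintegral h hf
  simpa only [lintegral_pointMeasure, lintegral_smul_measure, smul_eq_mul] using this

lemma measurable_tsum (h : IsStationaryPPP P Φ l) {f : Plane → ℝ≥0∞} (hf : Measurable f) :
    Measurable fun ω => ∑' x : Φ ω, f x := by
  have := (Measure.measurable_lintegral hf).comp (IsPoissonPointProcess.measurable_pointMeasure h)
  simpa only [Function.comp_def, lintegral_pointMeasure] using this

lemma lintegral_tsum_offDiag (h : IsStationaryPPP P Φ l) {f : Plane × Plane → ℝ≥0∞}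
    (hf : Measurable f) :
    ∫⁻ ω, ∑' p : (Φ ω).offDiag, f p ∂P = ENNReal.ofReal l ^ 2 * ∫⁻ p, f p := by
  have := IsPoissonPointProcess.lintegral_lintegral_offDiag h hf
  rw [Measure.prod_smul_left, Measure.prod_smul_right, smul_smul, ← sq,
    ← Measure.volume_eq_prod] at this
  simpa only [lintegral_pointMeasure, lintegral_smul_measure, smul_eq_mul] using this

lemma measurable_tsum_offDiag (h : IsStationaryPPP P Φ l) {f : Plane × Plane → ℝ≥0∞}
    (hf : Measurable f) : Measurable fun ω => ∑' p : (Φ ω).offDiag, f p := by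
  have := (Measure.measurable_lintegral hf).comp
    (IsPoissonPointProcess.measurable_pointMeasure_offDiag h)
  simpa only [Function.comp_def, lintegral_pointMeasure] using this

lemma measure_le_ncard_le (h : IsStationaryPPP P Φ l) {A : Set Plane} (hA : MeasurableSet A)
    (hb : Bornology.IsBounded A) (m : ℕ) :
    P {ω | m ≤ (Φ ω ∩ A).ncard} ≤ (ENNReal.ofReal l * volume A) ^ m := by
  simpa using IsPoissonPointProcess.measure_le_ncard_le h hA hb m

lemma measure_le_tsum_le (h : IsStationaryPPP P Φ l) {f : Plane → ℝ≥0∞} (hf : Measurable f)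
    {ε : ℝ≥0∞} (hε : ε ≠ 0) (hε' : ε ≠ ∞) :
    P {ω | ε ≤ ∑' x : Φ ω, f x} ≤ ENNReal.ofReal l * ((∫⁻ x, f x) / ε) := by
  refine (meas_ge_le_lintegral_div (h.measurable_tsum hf).aemeasurable hε hε').trans ?_
  rw [h.lintegral_tsum hf, mul_div_assoc]

lemma measure_le_tsum_offDiag_le (h : IsStationaryPPP P Φ l) {f : Plane × Plane → ℝ≥0∞}
    (hf : Measurable f) {ε : ℝ≥0∞} (hε : ε ≠ 0) (hε' : ε ≠ ∞) :
    P {ω | ε ≤ ∑' p : (Φ ω).offDiag, f p} ≤ ENNReal.ofReal l ^ 2 * ((∫⁻ p, f p) / ε) := by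
  refine (meas_ge_le_lintegral_div (h.measurable_tsum_offDiag hf).aemeasurable hε hε').trans ?_
  rw [h.lintegral_tsum_offDiag hf, mul_div_assoc]

variable {f g : Plane → ℝ≥0∞} {s t : ℝ≥0∞}

/-- With `N` the number of points in `C`, `N ≤ 1_S + N (N - 1)`, because one point of `C` already
forces exceedance. Taking expectations gives the bound. -/
lemma mul_volume_le (h : IsStationaryPPP P Φ l) {C : Set Plane} (hC : MeasurableSet C)
    (hb : Bornology.IsBounded C) (hCf : ∀ x ∈ C, s < f x ∧ t < g x) :
    ENNReal.ofReal l * volume C ≤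
      P {ω | Φ ω ∈ exceedance f g s t} + (ENNReal.ofReal l * volume C) ^ 2 := by
  have hmom : ∀ m : ℕ, ∫⁻ ω, (((Φ ω ∩ C).ncard.descFactorial m : ℕ) : ℝ≥0∞) ∂P =
      (ENNReal.ofReal l * volume C) ^ m := fun m => by
    simpa using IsPoissonPointProcess.lintegral_descFactorial h hC hb m
  have hmeas : ∀ m : ℕ, Measurable fun ω => (((Φ ω ∩ C).ncard.descFactorial m : ℕ) : ℝ≥0∞) :=
    fun m => (Measurable.of_discrete (f := fun k : ℕ => ((k.descFactorial m : ℕ) : ℝ≥0∞))).comp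
      (IsPoissonPointProcess.measurable_ncard h hC)
  set S := {ω | Φ ω ∈ exceedance f g s t}
  calc ENNReal.ofReal l * volume C
      = ∫⁻ ω, (((Φ ω ∩ C).ncard.descFactorial 1 : ℕ) : ℝ≥0∞) ∂P := by rw [hmom 1, pow_one]
    _ ≤ ∫⁻ ω, (S.indicator 1 ω + (((Φ ω ∩ C).ncard.descFactorial 2 : ℕ) : ℝ≥0∞)) ∂P := by
        refine lintegral_mono fun ω => ?_
        rcases Nat.eq_zero_or_pos (Φ ω ∩ C).ncard with h0 | h0
        · simp [h0]
        · obtain ⟨x, hx⟩ := Set.nonempty_of_ncard_ne_zero h0.ne'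
          have hS : ω ∈ S := ⟨(hCf x hx.2).1.trans_le (ENNReal.le_tsum (f := fun x : Φ ω => f x)
              (⟨x, hx.1⟩ : Φ ω)),
            (hCf x hx.2).2.trans_le (ENNReal.le_tsum (f := fun x : Φ ω => g x)
              (⟨x, hx.1⟩ : Φ ω))⟩
          rw [Set.indicator_of_mem hS, Pi.one_apply]
          have : ∀ n : ℕ, 0 < n → n.descFactorial 1 ≤ 1 + n.descFactorial 2 := by
            intro n hn
            obtain ⟨k, rfl⟩ := Nat.exists_eq_add_of_lt hn
            simp [Nat.descFactorial]
            nlinarith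
          exact (Nat.cast_le (α := ℝ≥0∞).2 (this _ h0)).trans (by push_cast; rfl)
    _ = ∫⁻ ω, S.indicator 1 ω ∂P + (ENNReal.ofReal l * volume C) ^ 2 := by
        rw [lintegral_add_right _ (hmeas 2), hmom 2]
    _ ≤ _ := by gcongr; exact lintegral_indicator_one_le S

/-- The pair analogue: if some pair of `C` lies in `W`, exceedance holds, and the number of such
ordered pairs is at most `N (N - 1) ≤ 2 + N (N - 1) (N - 2)`. The 2 counts both orders of a single
pair. -/
lemma sq_mul_volume_le (h : IsStationaryPPP P Φ l) {C : Set Plane} (hC : MeasurableSet C)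
    (hb : Bornology.IsBounded C) {W : Set (Plane × Plane)} (hW : MeasurableSet W)
    (hWf : ∀ p ∈ W, s < f p.1 + f p.2 ∧ t < g p.1 + g p.2) :
    ENNReal.ofReal l ^ 2 * volume (W ∩ C ×ˢ C) ≤
      2 * P {ω | Φ ω ∈ exceedance f g s t} + (ENNReal.ofReal l * volume C) ^ 3 := by
  have hmom : ∫⁻ ω, (((Φ ω ∩ C).ncard.descFactorial 3 : ℕ) : ℝ≥0∞) ∂P =
      (ENNReal.ofReal l * volume C) ^ 3 := by
    simpa using IsPoissonPointProcess.lintegral_descFactorial h hC hb 3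
  have hmeas : Measurable fun ω => (((Φ ω ∩ C).ncard.descFactorial 3 : ℕ) : ℝ≥0∞) :=
    (Measurable.of_discrete (f := fun k : ℕ => ((k.descFactorial 3 : ℕ) : ℝ≥0∞))).comp
      (IsPoissonPointProcess.measurable_ncard h hC)
  set S := {ω | Φ ω ∈ exceedance f g s t}
  have hWC : MeasurableSet (W ∩ C ×ˢ C) := hW.inter (hC.prod hC)
  calc ENNReal.ofReal l ^ 2 * volume (W ∩ C ×ˢ C)
      = ∫⁻ ω, ∑' p : (Φ ω).offDiag, (W ∩ C ×ˢ C).indicator (fun _ => (1 : ℝ≥0∞)) p ∂P := by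
        rw [h.lintegral_tsum_offDiag (measurable_const.indicator hWC),
          lintegral_indicator_const hWC, one_mul]
    _ ≤ ∫⁻ ω, (2 * S.indicator 1 ω + (((Φ ω ∩ C).ncard.descFactorial 3 : ℕ) : ℝ≥0∞)) ∂P := by
        refine lintegral_mono fun ω => ?_
        dsimp only
        rw [tsum_indicator_one]
        rcases Set.eq_empty_or_nonempty ((Φ ω).offDiag ∩ (W ∩ C ×ˢ C)) with h0 | ⟨p, hp⟩
        · simp [h0]
        · have hfin := IsPoissonPointProcess.locallyFinite h ω C hb
          have hS : ω ∈ S := by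
            classical
            have hsub : ∀ u : Plane → ℝ≥0∞, u p.1 + u p.2 ≤ ∑' x : Φ ω, u x := by
              intro u
              have hne : (⟨p.1, hp.1.1⟩ : Φ ω) ≠ ⟨p.2, hp.1.2.1⟩ := fun he =>
                hp.1.2.2 (congrArg Subtype.val he)
              have := ENNReal.sum_le_tsum (f := fun x : Φ ω => u x)
                {⟨p.1, hp.1.1⟩, ⟨p.2, hp.1.2.1⟩}
              rwa [Finset.sum_pair hne] at this
            exact ⟨(hWf p hp.2.1).1.trans_le (hsub f), (hWf p hp.2.1).2.trans_le (hsub g)⟩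
          rw [Set.indicator_of_mem hS]
          have hle : ((Φ ω).offDiag ∩ (W ∩ C ×ˢ C)).encard ≤ (Φ ω ∩ C).offDiag.encard := by
            refine Set.encard_le_encard ?_
            rintro ⟨x, y⟩ ⟨⟨h1, h2, h3⟩, -, h4, h5⟩
            exact ⟨⟨h1, h4⟩, ⟨h2, h5⟩, h3⟩
          rw [encard_offDiag_of_finite hfin] at hle
          have hle' := ENat.toENNReal_le.2 hle
          refine hle'.trans ?_
          have : ∀ n : ℕ, n.descFactorial 2 ≤ 2 * 1 + n.descFactorial 3 := by
            intro n
            match n with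
            | 0 => simp
            | 1 => simp
            | 2 => simp [Nat.descFactorial]
            | k + 3 =>
              simp [Nat.descFactorial]
              nlinarith [Nat.zero_le (k * ((k + 2) * (k + 3)))]
          have h3 := this (Φ ω ∩ C).ncard
          simp only [ENat.toENNReal_coe, Pi.one_apply]
          exact_mod_cast h3
    _ = ∫⁻ ω, 2 * S.indicator 1 ω ∂P + (ENNReal.ofReal l * volume C) ^ 3 := by
        rw [lintegral_add_right _ hmeas, hmom]
    _ ≤ _ := by
        gcongr
        rw [lintegral_const_mul' _ _ (by simp)]
        gcongr
        exact lintegral_indicator_one_le S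

end IsStationaryPPP

namespace IsStationaryPPP

variable {Ω : Type*} [MeasurableSpace Ω] {P : Measure Ω} {Φ : Ω → Set Plane} {l : ℝ}
  {f g : Plane → ℝ≥0∞} {s t : ℝ≥0∞}

/-- If `C` holds at most one point and the far field stays below `ε`, a lone near point must meet
the thresholds lowered by `ε`. Having no near point is impossible since `ε < s`. -/
lemma measure_exceedance_le (h : IsStationaryPPP P Φ l) (hf : Measurable f) (hg : Measurable g)
    {ε : ℝ≥0∞} (hε : ε ≠ 0) (hεs : ε < s) {C : Set Plane} (hC : MeasurableSet C)
    (hb : Bornology.IsBounded C) :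
    P {ω | Φ ω ∈ exceedance f g s t} ≤
      ENNReal.ofReal l * (volume {x | s ≤ f x + ε ∧ t ≤ g x + ε} +
        (∫⁻ x in Cᶜ, (f x + g x)) / ε) + (ENNReal.ofReal l * volume C) ^ 2 := by
  set A := {x | s ≤ f x + ε ∧ t ≤ g x + ε}
  have hA : MeasurableSet A := (measurableSet_le measurable_const (hf.add_const ε)).inter
    (measurableSet_le measurable_const (hg.add_const ε))
  have hε' : ε ≠ ∞ := hεs.ne_top
  have hfg : Measurable (Cᶜ.indicator fun x => f x + g x) := (hf.add hg).indicator hC.compl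
  have hsub : {ω | Φ ω ∈ exceedance f g s t} ⊆
      ({ω | 1 ≤ ∑' x : Φ ω, A.indicator (fun _ => (1 : ℝ≥0∞)) x} ∪
        {ω | ε ≤ ∑' x : Φ ω, Cᶜ.indicator (fun x => f x + g x) x}) ∪
        {ω | 2 ≤ (Φ ω ∩ C).ncard} := by
    intro ω hω
    by_contra hnot
    simp only [Set.mem_union, Set.mem_ofPred_eq, not_or, not_le] at hnot
    obtain ⟨⟨h1, h2⟩, h3⟩ := hnot
    have hfin := IsPoissonPointProcess.locallyFinite h ω C hb
    have hfar : ∀ u : Plane → ℝ≥0∞, (∀ x, u x ≤ f x + g x) →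
        ∑' x : Φ ω, Cᶜ.indicator u x ≤ ε := fun u hu =>
      (ENNReal.tsum_le_tsum fun x : Φ ω => Set.indicator_le_indicator (hu x)).trans h2.le
    have hff := hfar f fun x => le_self_add
    have hfg := hfar g fun x => le_add_self
    rcases Nat.lt_or_ge 0 (Φ ω ∩ C).ncard with h4 | h4
    · obtain ⟨x, hx⟩ := Set.ncard_eq_one.1 (show (Φ ω ∩ C).ncard = 1 by omega)
      have hdec := fun u : Plane → ℝ≥0∞ =>
        tsum_eq_finset_sum_add_tsum_indicator (Φ ω) C {x} (by simp [hx]) u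
      simp only [Finset.sum_singleton] at hdec
      have hxA : x ∈ A := by
        refine ⟨hω.1.le.trans ?_, hω.2.le.trans ?_⟩
        · rw [hdec f]; gcongr
        · rw [hdec g]; gcongr
      have hxφ : x ∈ Φ ω := (hx ▸ Set.mem_singleton x : x ∈ Φ ω ∩ C).1
      have := ENNReal.le_tsum (f := fun x : Φ ω => A.indicator (fun _ => (1 : ℝ≥0∞)) (x : Plane))
        (⟨x, hxφ⟩ : Φ ω)
      simp only [Set.indicator_of_mem hxA] at this
      exact absurd h1 (not_lt.2 this)
    · have hx : Φ ω ∩ C = ∅ := (Set.ncard_eq_zero hfin).1 (by omega)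
      have := tsum_eq_finset_sum_add_tsum_indicator (Φ ω) C ∅ (by simp [hx]) f
      rw [Finset.sum_empty, zero_add] at this
      exact absurd (hω.1.trans_le (this.le.trans hff)) (not_lt.2 hεs.le)
  refine (measure_mono hsub).trans ((measure_union_le _ _).trans ?_)
  refine add_le_add ((measure_union_le _ _).trans ?_) (h.measure_le_ncard_le hC hb 2)
  rw [mul_add]
  refine add_le_add ?_ ?_
  · refine (h.measure_le_tsum_le (measurable_const.indicator hA) one_ne_zero
      ENNReal.one_ne_top).trans (le_of_eq ?_)
    rw [lintegral_indicator_const hA, one_mul, div_one]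
  · refine (h.measure_le_tsum_le hfg hε hε').trans (le_of_eq ?_)
    rw [lintegral_indicator hC.compl]

/-- Unless kernel mass at least 1 comes from pairs outside `B ×ˢ B`, there is a pair inside. Barring
a third point in `C` and a far field of size `ε`, that pair alone meets the lowered thresholds. The
far field is counted jointly with a point of `B`, through `F`, so that this error is of order `l ^
2` and not `l`. -/
lemma measure_exceedance_le_of_kernel (h : IsStationaryPPP P Φ l) (hf : Measurable f)
    (hg : Measurable g) {k : Plane × Plane → ℝ≥0∞} (hk : Measurable k)
    (hdom : ∀ φ ∈ exceedance f g s t, 1 ≤ ∑' p : φ.offDiag, k p)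
    {ε : ℝ≥0∞} (hε : ε ≠ 0) (hε' : ε ≠ ∞) {B C : Set Plane} (hB : MeasurableSet B)
    (hC : MeasurableSet C) (hb : Bornology.IsBounded C) (hBC : B ⊆ C) :
    P {ω | Φ ω ∈ exceedance f g s t} ≤
      ENNReal.ofReal l ^ 2 *
        (volume ({p | s ≤ f p.1 + f p.2 + ε ∧ t ≤ g p.1 + g p.2 + ε} ∩ B ×ˢ B) / 2 +
        (∫⁻ p in (B ×ˢ B)ᶜ, k p) + volume B * (∫⁻ x in Cᶜ, (f x + g x)) / ε) +
      (ENNReal.ofReal l * volume C) ^ 3 := by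
  set W := {p : Plane × Plane | s ≤ f p.1 + f p.2 + ε ∧ t ≤ g p.1 + g p.2 + ε} ∩ B ×ˢ B
  have hsum : ∀ {u : Plane → ℝ≥0∞}, Measurable u →
      Measurable fun p : Plane × Plane => u p.1 + u p.2 + ε := fun hu =>
    ((hu.comp measurable_fst).add (hu.comp measurable_snd)).add_const ε
  have hW : MeasurableSet W := ((measurableSet_le measurable_const (hsum hf)).inter
    (measurableSet_le measurable_const (hsum hg))).inter (hB.prod hB)
  have hBB : MeasurableSet (B ×ˢ B)ᶜ := (hB.prod hB).compl
  set F : Plane × Plane → ℝ≥0∞ := fun p =>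
    B.indicator 1 p.1 * Cᶜ.indicator (fun x => f x + g x) p.2 with hFdef
  have hm1 : Measurable (B.indicator (1 : Plane → ℝ≥0∞)) := measurable_one.indicator hB
  have hm2 : Measurable (Cᶜ.indicator fun x => f x + g x) := (hf.add hg).indicator hC.compl
  have hF : Measurable F := (hm1.comp measurable_fst).mul (hm2.comp measurable_snd)
  have hsub : {ω | Φ ω ∈ exceedance f g s t} ⊆
      (({ω | 2 ≤ ∑' p : (Φ ω).offDiag, W.indicator (fun _ => (1 : ℝ≥0∞)) p} ∪
        {ω | 1 ≤ ∑' p : (Φ ω).offDiag, (B ×ˢ B)ᶜ.indicator k p}) ∪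
        {ω | ε ≤ ∑' p : (Φ ω).offDiag, F p}) ∪
        {ω | 3 ≤ (Φ ω ∩ C).ncard} := by
    classical
    intro ω hω
    by_contra hnot
    simp only [Set.mem_union, Set.mem_ofPred_eq, not_or, not_le] at hnot
    obtain ⟨⟨⟨h1, h2⟩, h3⟩, h4⟩ := hnot
    have hfin := IsPoissonPointProcess.locallyFinite h ω C hb
    obtain ⟨⟨x, y⟩, hp, hpB⟩ : ∃ p ∈ (Φ ω).offDiag, p ∈ B ×ˢ B := by
      by_contra hne
      push Not at hne
      refine absurd h2 (not_lt.2 ((hdom _ hω).trans (ENNReal.tsum_le_tsum fun p => ?_)))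
      rw [Set.indicator_of_mem (hne p p.2)]
    obtain ⟨hx, hy, hxy⟩ : x ∈ Φ ω ∧ y ∈ Φ ω ∧ x ≠ y := hp
    obtain ⟨hxB, hyB⟩ : x ∈ B ∧ y ∈ B := hpB
    have hxyC : ({x, y} : Set Plane) = Φ ω ∩ C := by
      refine Set.eq_of_subset_of_ncard_le ?_ ?_ hfin
      · rintro z (rfl | rfl)
        exacts [⟨hx, hBC hxB⟩, ⟨hy, hBC hyB⟩]
      · rw [Set.ncard_pair hxy]; omega
    have hfar : ∀ u : Plane → ℝ≥0∞, (∀ x, u x ≤ f x + g x) →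
        ∑' x : Φ ω, Cᶜ.indicator u x ≤ ε := fun u hu => by
      refine (tsum_indicator_le_tsum_offDiag hx (hBC hxB) u F fun z hz => ?_).trans h3.le
      simp only [hFdef, Set.indicator_of_mem hxB, Set.indicator_of_mem hz, Pi.one_apply, one_mul]
      exact hu z
    have hff := hfar f fun x => le_self_add
    have hfg := hfar g fun x => le_add_self
    have hdec := fun u : Plane → ℝ≥0∞ =>
      tsum_eq_finset_sum_add_tsum_indicator (Φ ω) C {x, y} (by simp [← hxyC]) u
    simp only [Finset.sum_pair hxy] at hdec
    have h5 : s ≤ f x + f y + ε := hω.1.le.trans (by rw [hdec f]; gcongr)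
    have h6 : t ≤ g x + g y + ε := hω.2.le.trans (by rw [hdec g]; gcongr)
    -- `W` is symmetric, so both orders are counted. Markov's inequality can thus be applied at
    -- level 2, which yields the sharp factor one half.
    have hpair : ({(x, y), (y, x)} : Set (Plane × Plane)) ⊆ (Φ ω).offDiag ∩ W := by
      rintro z (rfl | rfl)
      · exact ⟨⟨hx, hy, hxy⟩, ⟨h5, h6⟩, hxB, hyB⟩
      · exact ⟨⟨hy, hx, hxy.symm⟩, ⟨(add_comm (f y) (f x)) ▸ h5, (add_comm (g y) (g x)) ▸ h6⟩,
          hyB, hxB⟩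
    rw [tsum_indicator_one] at h1
    have h7 := Set.encard_le_encard hpair
    rw [Set.encard_pair (fun he => hxy (congrArg Prod.fst he))] at h7
    have h8 := ENat.toENNReal_le.2 h7
    exact absurd h1 (not_lt.2 (by simpa using h8))
  refine (measure_mono hsub).trans ((measure_union_le _ _).trans ?_)
  refine add_le_add ((measure_union_le _ _).trans ?_) (h.measure_le_ncard_le hC hb 3)
  rw [mul_add, mul_add]
  refine add_le_add ((measure_union_le _ _).trans (add_le_add ?_ ?_)) ?_
  · refine (h.measure_le_tsum_offDiag_le (measurable_const.indicator hW) two_ne_zero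
      ENNReal.ofNat_ne_top).trans (le_of_eq ?_)
    rw [lintegral_indicator_const hW, one_mul]
  · refine (h.measure_le_tsum_offDiag_le (hk.indicator hBB) one_ne_zero
      ENNReal.one_ne_top).trans (le_of_eq ?_)
    rw [lintegral_indicator hBB, div_one]
  · refine (h.measure_le_tsum_offDiag_le hF hε hε').trans (le_of_eq ?_)
    congr 2
    rw [Measure.volume_eq_prod, lintegral_prod_mul hm1.aemeasurable hm2.aemeasurable,
      lintegral_indicator_one hB, lintegral_indicator hC.compl]

end IsStationaryPPP

/-! ### First- and second-order asymptotics of exceedance -/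

section Asymptotics

variable {Ω : ℝ → Type*} [∀ l, MeasurableSpace (Ω l)] {P : ∀ l, Measure (Ω l)}
  {Φ : ∀ l, Ω l → Set Plane} {f g : Plane → ℝ≥0∞} {s t : ℝ≥0∞}

lemma tendsto_setLIntegral_compl_closedBall {h : Plane → ℝ≥0∞} (hh : ∫⁻ x, h x ≠ ∞) :
    Tendsto (fun n : ℕ => ∫⁻ x in (Metric.closedBall (0 : Plane) n)ᶜ, h x) atTop (𝓝 0) := by
  refine tendsto_setLIntegral_of_antitone hh (fun n => measurableSet_closedBall.compl) ?_ ?_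
  · exact fun a b hab => Set.compl_subset_compl.2
      (Metric.closedBall_subset_closedBall (by exact_mod_cast hab))
  · rw [← Set.compl_iUnion, Metric.iUnion_closedBall_nat, Set.compl_univ]

lemma monotone_closedBall_prod_closedBall :
    Monotone fun n : ℕ => Metric.closedBall (0 : Plane) n ×ˢ Metric.closedBall (0 : Plane) n :=
  fun a b hab => by
    have : Metric.closedBall (0 : Plane) a ⊆ Metric.closedBall (0 : Plane) b :=
      Metric.closedBall_subset_closedBall (by exact_mod_cast hab)
    exact Set.prod_mono this this

lemma iUnion_closedBall_prod_closedBall :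
    ⋃ n : ℕ, Metric.closedBall (0 : Plane) n ×ˢ Metric.closedBall (0 : Plane) n = Set.univ := by
  rw [Set.iUnion_prod_of_monotone, Metric.iUnion_closedBall_nat, Set.univ_prod_univ] <;>
  exact fun a b hab => Metric.closedBall_subset_closedBall (by exact_mod_cast hab)

lemma iInter_le_add_eq {E : Type*} {u v : E → ℝ≥0∞} {e : ℕ → ℝ≥0∞}
    (he : Tendsto e atTop (𝓝 0)) (s t : ℝ≥0∞) :
    ⋂ n, {x | s ≤ u x + e n ∧ t ≤ v x + e n} = {x | s ≤ u x ∧ t ≤ v x} := by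
  ext x
  simp only [Set.mem_iInter, Set.mem_ofPred_eq]
  refine ⟨fun hx => ⟨?_, ?_⟩, fun hx n => ⟨hx.1.trans le_self_add, hx.2.trans le_self_add⟩⟩
  · have : Tendsto (fun n => u x + e n) atTop (𝓝 (u x)) := by
      simpa using tendsto_const_nhds.add he
    exact ge_of_tendsto' this fun n => (hx n).1
  · have : Tendsto (fun n => v x + e n) atTop (𝓝 (v x)) := by
      simpa using tendsto_const_nhds.add he
    exact ge_of_tendsto' this fun n => (hx n).2

lemma antitone_le_add {E : Type*} {u v : E → ℝ≥0∞} {e : ℕ → ℝ≥0∞} (he : Antitone e)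
    (s t : ℝ≥0∞) : Antitone fun n => {x | s ≤ u x + e n ∧ t ≤ v x + e n} :=
  fun _ _ hab _ hx => ⟨hx.1.trans (add_le_add_right (he hab) _),
    hx.2.trans (add_le_add_right (he hab) _)⟩

/-- First-order asymptotics of the exceedance probability as the density vanishes. -/
theorem tendsto_measure_exceedance_div
    (hΦ : ∀ l, 0 < l → IsStationaryPPP (P l) (Φ l) l) (hf : Measurable f) (hg : Measurable g)
    (hfi : ∫⁻ x, f x ≠ ∞) (hgi : ∫⁻ x, g x ≠ ∞)
    (hfnull : ∀ c, volume {x | f x = c} = 0) (hgnull : ∀ c, volume {x | g x = c} = 0)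
    (hs : 0 < s) (hs' : s ≠ ∞) :
    Tendsto (fun l => P l {ω | Φ l ω ∈ exceedance f g s t} / ENNReal.ofReal l) (𝓝[>] 0)
      (𝓝 (volume {x | s < f x ∧ t < g x})) := by
  set A := {x | s < f x ∧ t < g x}
  have hA : MeasurableSet A :=
    (measurableSet_lt measurable_const hf).inter (measurableSet_lt measurable_const hg)
  have hpow : (fun l => P l {ω | Φ l ω ∈ exceedance f g s t} / ENNReal.ofReal l) =
      fun l => P l {ω | Φ l ω ∈ exceedance f g s t} / ENNReal.ofReal l ^ 1 := by simp
  rw [hpow]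
  have hball : ∀ n : ℕ, volume (Metric.closedBall (0 : Plane) n) ≠ ∞ := fun n =>
    Metric.isBounded_closedBall.measure_lt_top.ne
  refine tendsto_of_le_liminf_of_limsup_le ?_ ?_
  · have hmono : Tendsto (fun n : ℕ => volume (A ∩ Metric.closedBall (0 : Plane) n)) atTop
        (𝓝 (volume A)) := by
      have := tendsto_measure_iUnion_atTop (μ := (volume : Measure Plane))
        (s := fun n : ℕ => A ∩ Metric.closedBall (0 : Plane) n) (fun a b hab =>
          Set.inter_subset_inter_right _
            (Metric.closedBall_subset_closedBall (by exact_mod_cast hab)))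
      rwa [← Set.inter_iUnion, Metric.iUnion_closedBall_nat, Set.inter_univ] at this
    refine le_of_tendsto' hmono fun n => ?_
    have hb : Bornology.IsBounded (A ∩ Metric.closedBall (0 : Plane) n) :=
      Metric.isBounded_closedBall.subset Set.inter_subset_right
    refine le_liminf_div_ofReal_pow (b := volume (A ∩ Metric.closedBall (0 : Plane) n) ^ 2) 1
      (ENNReal.pow_ne_top hb.measure_lt_top.ne) fun l hl => ?_
    have := (hΦ l hl).mul_volume_le (hA.inter measurableSet_closedBall) hb (f := f) (g := g)
      (s := s) (t := t) fun x hx => hx.1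
    rwa [mul_pow, ← pow_one (ENNReal.ofReal l), ← pow_mul, one_mul] at this
  · obtain ⟨e, hea, hemem, he0⟩ := exists_seq_strictAnti_tendsto' hs
    set T : ℕ → Set Plane := fun n => {x | s ≤ f x + e n ∧ t ≤ g x + e n}
    have hTm : ∀ n, MeasurableSet (T n) := fun n =>
      (measurableSet_le measurable_const (hf.add_const _)).inter
        (measurableSet_le measurable_const (hg.add_const _))
    have hle : ∀ n, limsup (fun l => P l {ω | Φ l ω ∈ exceedance f g s t} / ENNReal.ofReal l ^ 1)
        (𝓝[>] 0) ≤ volume (T n) := by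
      intro n
      have hlim : Tendsto (fun m : ℕ => volume (T n) +
          (∫⁻ x in (Metric.closedBall (0 : Plane) m)ᶜ, (f x + g x)) / e n) atTop
          (𝓝 (volume (T n))) := by
        have h1 := ENNReal.Tendsto.div_const (tendsto_setLIntegral_compl_closedBall
          (h := fun x => f x + g x) (by
            rw [lintegral_add_left hf]; exact ENNReal.add_ne_top.2 ⟨hfi, hgi⟩))
          (b := e n) (Or.inr (hemem n).1.ne')
        simpa using tendsto_const_nhds.add h1
      refine ge_of_tendsto' hlim fun m => ?_
      refine limsup_div_ofReal_pow_le (b := volume (Metric.closedBall (0 : Plane) m) ^ 2) 1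
        (ENNReal.pow_ne_top (hball m)) fun l hl => ?_
      have := (hΦ l hl).measure_exceedance_le hf hg (t := t) (hemem n).1.ne' (hemem n).2
        (C := Metric.closedBall (0 : Plane) m) measurableSet_closedBall Metric.isBounded_closedBall
      rwa [mul_pow, ← pow_one (ENNReal.ofReal l), ← pow_mul, one_mul] at this
    -- Continuity from above needs one set of finite volume: `T 0` lies in a superlevel set of the
    -- integrable `f` at the positive level `s - e 0`.
    have hfin : volume (T 0) ≠ ∞ := by
      have h1 : T 0 ⊆ {x | s - e 0 ≤ f x} := fun x hx => tsub_le_iff_right.2 hx.1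
      have h2 : s - e 0 ≠ 0 := (tsub_pos_of_lt (hemem 0).2).ne'
      have h3 := meas_ge_le_lintegral_div (μ := volume) hf.aemeasurable h2
        (ENNReal.sub_ne_top hs')
      exact ((measure_mono h1).trans_lt (h3.trans_lt (ENNReal.div_lt_top hfi h2))).ne
    have hlim := tendsto_measure_iInter_atTop (μ := (volume : Measure Plane))
      (fun n => (hTm n).nullMeasurableSet) (antitone_le_add hea.antitone s t) ⟨0, hfin⟩
    rw [iInter_le_add_eq he0] at hlim
    refine (ge_of_tendsto' hlim hle).trans ?_
    -- Non-strict thresholds add only level sets of `f` and `g`, which are null.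
    have hsub : {x | s ≤ f x ∧ t ≤ g x} ⊆ A ∪ ({x | f x = s} ∪ {x | g x = t}) := by
      rintro x ⟨h1, h2⟩
      rcases h1.eq_or_lt with h1 | h1
      · exact Or.inr (Or.inl h1.symm)
      · rcases h2.eq_or_lt with h2 | h2
        · exact Or.inr (Or.inr h2.symm)
        · exact Or.inl ⟨h1, h2⟩
    refine (measure_mono hsub).trans ((measure_union_le _ _).trans ?_)
    rw [measure_union_null (hfnull s) (hgnull t), add_zero]

/-- By Fubini: for fixed first point, the section lies in a level set of `u`. -/
lemma volume_add_eq_const_eq_zero {u : Plane → ℝ≥0∞} (hu : Measurable u) (hut : ∀ x, u x ≠ ∞)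
    (hnull : ∀ c, volume {x | u x = c} = 0) (c : ℝ≥0∞) :
    volume {p : Plane × Plane | u p.1 + u p.2 = c} = 0 := by
  have hm : MeasurableSet {p : Plane × Plane | u p.1 + u p.2 = c} :=
    measurableSet_eq_fun ((hu.comp measurable_fst).add (hu.comp measurable_snd)) measurable_const
  rw [Measure.volume_eq_prod, Measure.measure_prod_null hm]
  refine Eventually.of_forall fun x => measure_mono_null ?_ (hnull (c - u x))
  intro y hy
  have hy' : u x + u y = c := hy
  exact ENNReal.eq_sub_of_add_eq (hut x) (by rw [add_comm]; exact hy')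

/-- Second-order asymptotics of the exceedance probability as the density vanishes, when
exceedance forces an integrable pair interaction. -/
theorem tendsto_measure_exceedance_div_sq
    (hΦ : ∀ l, 0 < l → IsStationaryPPP (P l) (Φ l) l) (hf : Measurable f) (hg : Measurable g)
    (hft : ∀ x, f x ≠ ∞) (hgt : ∀ x, g x ≠ ∞)
    (hfi : ∫⁻ x, f x ≠ ∞) (hgi : ∫⁻ x, g x ≠ ∞)
    (hfnull : ∀ c, volume {x | f x = c} = 0) (hgnull : ∀ c, volume {x | g x = c} = 0)
    {k : Plane × Plane → ℝ≥0∞} (hk : Measurable k) (hki : ∫⁻ p, k p ≠ ∞)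
    (hdom : ∀ φ ∈ exceedance f g s t, 1 ≤ ∑' p : φ.offDiag, k p) :
    Tendsto (fun l => P l {ω | Φ l ω ∈ exceedance f g s t} / ENNReal.ofReal l ^ 2) (𝓝[>] 0)
      (𝓝 (volume {p : Plane × Plane | s < f p.1 + f p.2 ∧ t < g p.1 + g p.2} / 2)) ∧
    volume {p : Plane × Plane | s < f p.1 + f p.2 ∧ t < g p.1 + g p.2} ≠ ∞ := by
  set W := {p : Plane × Plane | s < f p.1 + f p.2 ∧ t < g p.1 + g p.2}
  have hsum : ∀ {u : Plane → ℝ≥0∞}, Measurable u →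
      Measurable fun p : Plane × Plane => u p.1 + u p.2 := fun hu =>
    (hu.comp measurable_fst).add (hu.comp measurable_snd)
  have hW : MeasurableSet W := (measurableSet_lt measurable_const (hsum hf)).inter
    (measurableSet_lt measurable_const (hsum hg))
  have hball : ∀ n : ℕ, volume (Metric.closedBall (0 : Plane) n) ≠ ∞ := fun n =>
    Metric.isBounded_closedBall.measure_lt_top.ne
  set D : ℕ → Set (Plane × Plane) := fun n =>
    Metric.closedBall (0 : Plane) n ×ˢ Metric.closedBall (0 : Plane) n
  have hD : ∀ n, MeasurableSet (D n) := fun n =>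
    measurableSet_closedBall.prod measurableSet_closedBall
  have hDfin : ∀ n, volume (D n) ≠ ∞ := fun n => by
    rw [Measure.volume_eq_prod, Measure.prod_prod]
    exact ENNReal.mul_ne_top (hball n) (hball n)
  set q := fun l => P l {ω | Φ l ω ∈ exceedance f g s t} / ENNReal.ofReal l ^ 2
  have hinf : volume W / 2 ≤ liminf q (𝓝[>] 0) := by
    have hmono : Tendsto (fun n : ℕ => volume (W ∩ D n) / 2) atTop (𝓝 (volume W / 2)) := by
      have := tendsto_measure_iUnion_atTop (μ := (volume : Measure (Plane × Plane)))
        (s := fun n : ℕ => W ∩ D n) (fun a b hab =>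
          Set.inter_subset_inter_right _ (monotone_closedBall_prod_closedBall hab))
      rw [← Set.inter_iUnion, iUnion_closedBall_prod_closedBall, Set.inter_univ] at this
      exact ENNReal.Tendsto.div_const this (Or.inr two_ne_zero)
    refine le_of_tendsto' hmono fun n => ?_
    refine le_liminf_div_ofReal_pow (b := volume (Metric.closedBall (0 : Plane) n) ^ 3 / 2) 2
      (ENNReal.div_lt_top (ENNReal.pow_ne_top (hball n)) two_ne_zero).ne fun l hl => ?_
    have := (hΦ l hl).sq_mul_volume_le measurableSet_closedBall
      (Metric.isBounded_closedBall (x := (0 : Plane)) (r := n)) hW (f := f) (g := g)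
      (s := s) (t := t) fun x hx => hx
    rw [← mul_div_assoc, ← mul_div_assoc, ← mul_pow]
    refine (ENNReal.div_le_div_right this 2).trans (le_of_eq ?_)
    rw [ENNReal.add_div, mul_comm (2 : ℝ≥0∞), ENNReal.mul_div_cancel_right two_ne_zero
      ENNReal.ofNat_ne_top]
  obtain ⟨e, hea, hemem, he0⟩ := exists_seq_strictAnti_tendsto' (zero_lt_one (α := ℝ≥0∞))
  set T : ℕ → Set (Plane × Plane) := fun j =>
    {p | s ≤ f p.1 + f p.2 + e j ∧ t ≤ g p.1 + g p.2 + e j}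
  have hTm : ∀ j, MeasurableSet (T j) := fun j =>
    (measurableSet_le measurable_const ((hsum hf).add_const _)).inter
      (measurableSet_le measurable_const ((hsum hg).add_const _))
  -- The order of limits matters: `C` grows to the plane first (`m`), then `ε = e j` tends to 0, and
  -- `B`, of radius `n`, grows last. The far-field error carries the factor `volume B / ε`, so both
  -- must be fixed while `C` grows.
  have hle1 : ∀ n j, limsup q (𝓝[>] 0) ≤ volume (T j ∩ D n) / 2 + ∫⁻ p in (D n)ᶜ, k p := by
    intro n j
    have hlim : Tendsto (fun m : ℕ => (volume (T j ∩ D n) / 2 + ∫⁻ p in (D n)ᶜ, k p) +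
        volume (Metric.closedBall (0 : Plane) n) *
          (∫⁻ x in (Metric.closedBall (0 : Plane) m)ᶜ, (f x + g x)) / e j) atTop
        (𝓝 (volume (T j ∩ D n) / 2 + ∫⁻ p in (D n)ᶜ, k p)) := by
      have h1 := ENNReal.Tendsto.div_const (ENNReal.Tendsto.const_mul
        (tendsto_setLIntegral_compl_closedBall
        (h := fun x => f x + g x) (by
          rw [lintegral_add_left hf]; exact ENNReal.add_ne_top.2 ⟨hfi, hgi⟩))
          (a := volume (Metric.closedBall (0 : Plane) n)) (Or.inr (hball n)))
        (b := e j) (Or.inr (hemem j).1.ne')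
      simpa using tendsto_const_nhds.add h1
    refine ge_of_tendsto hlim ?_
    filter_upwards [eventually_ge_atTop n] with m hm
    refine limsup_div_ofReal_pow_le (b := volume (Metric.closedBall (0 : Plane) m) ^ 3) 2
      (ENNReal.pow_ne_top (hball m)) fun l hl => ?_
    have := (hΦ l hl).measure_exceedance_le_of_kernel hf hg hk hdom (hemem j).1.ne'
      (hemem j).2.ne_top (B := Metric.closedBall (0 : Plane) n)
      (C := Metric.closedBall (0 : Plane) m) measurableSet_closedBall measurableSet_closedBall
      Metric.isBounded_closedBall
      (Metric.closedBall_subset_closedBall (by exact_mod_cast hm))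
    rwa [mul_pow] at this
  have hle2 : ∀ n, limsup q (𝓝[>] 0) ≤ volume (W ∩ D n) / 2 + ∫⁻ p in (D n)ᶜ, k p := by
    intro n
    have hlim := tendsto_measure_iInter_atTop (μ := (volume : Measure (Plane × Plane)))
      (s := fun j => T j ∩ D n)
      (fun j => ((hTm j).inter (hD n)).nullMeasurableSet)
      (fun a b hab => Set.inter_subset_inter_left _ (antitone_le_add hea.antitone s t hab))
      ⟨0, ((measure_mono Set.inter_subset_right).trans_lt (hDfin n).lt_top).ne⟩
    rw [← Set.iInter_inter, iInter_le_add_eq he0] at hlim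
    have hlim2 := (ENNReal.Tendsto.div_const hlim (b := 2) (Or.inr two_ne_zero)).add_const
      (∫⁻ p in (D n)ᶜ, k p)
    refine (ge_of_tendsto' hlim2 (hle1 n)).trans ?_
    gcongr ?_ / 2 + _
    have hsub : {p : Plane × Plane | s ≤ f p.1 + f p.2 ∧ t ≤ g p.1 + g p.2} ∩ D n ⊆
        (W ∩ D n) ∪ ({p | f p.1 + f p.2 = s} ∪ {p | g p.1 + g p.2 = t}) := by
      rintro x ⟨⟨h1, h2⟩, h3⟩
      rcases h1.eq_or_lt with h1 | h1
      · exact Or.inr (Or.inl h1.symm)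
      · rcases h2.eq_or_lt with h2 | h2
        · exact Or.inr (Or.inr h2.symm)
        · exact Or.inl ⟨⟨h1, h2⟩, h3⟩
    refine (measure_mono hsub).trans ((measure_union_le _ _).trans ?_)
    rw [measure_union_null (volume_add_eq_const_eq_zero hf hft hfnull s)
      (volume_add_eq_const_eq_zero hg hgt hgnull t), add_zero]
  have hsup : limsup q (𝓝[>] 0) ≤ volume W / 2 := by
    have hκ : Tendsto (fun n => ∫⁻ p in (D n)ᶜ, k p) atTop (𝓝 0) := by
      refine tendsto_setLIntegral_of_antitone hki (fun n => (hD n).compl) ?_ ?_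
      · exact fun a b hab => Set.compl_subset_compl.2 (monotone_closedBall_prod_closedBall hab)
      · rw [← Set.compl_iUnion, iUnion_closedBall_prod_closedBall, Set.compl_univ]
    have hlim : Tendsto (fun n => volume W / 2 + ∫⁻ p in (D n)ᶜ, k p) atTop
        (𝓝 (volume W / 2)) := by
      simpa using tendsto_const_nhds.add hκ
    refine ge_of_tendsto' hlim fun n => (hle2 n).trans ?_
    gcongr
    exact Set.inter_subset_left
  -- Finiteness of `volume W` comes from the same bounds: half of it is below the liminf, while the
  -- limsup is finite by `hle2` at any single `n`.
  refine ⟨tendsto_of_le_liminf_of_limsup_le hinf hsup, fun htop => ?_⟩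
  have h1 : limsup q (𝓝[>] 0) < ∞ := by
    refine (hle2 0).trans_lt (ENNReal.add_lt_top.2 ⟨ENNReal.div_lt_top ?_ two_ne_zero,
      (setLIntegral_le_lintegral _ _).trans_lt hki.lt_top⟩)
    exact ((measure_mono Set.inter_subset_right).trans_lt (hDfin 0).lt_top).ne
  have h2 := hinf.trans (liminf_le_limsup (f := 𝓝[>] (0 : ℝ)))
  rw [htop, ENNReal.top_div_of_ne_top ENNReal.ofNat_ne_top] at h2
  exact absurd h1 (not_lt.2 h2)

end Asymptotics

/-! ### An integrable pair kernel dominating exceedance -/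

section Kernel

lemma rpow_tsum_le_tsum_rpow {ι : Type*} (u : ι → ℝ≥0∞) {p : ℝ} (hp : 0 < p) (hp1 : p ≤ 1) :
    (∑' i, u i) ^ p ≤ ∑' i, u i ^ p := by
  classical
  have hfin : ∀ F : Finset ι, (∑ i ∈ F, u i) ^ p ≤ ∑ i ∈ F, u i ^ p := by
    intro F
    induction F using Finset.induction_on with
    | empty => simp [hp]
    | insert a F ha ih =>
      rw [Finset.sum_insert ha, Finset.sum_insert ha]
      exact (ENNReal.rpow_add_le_add_rpow _ _ hp.le hp1).trans (by gcongr)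
  have hlim : Tendsto (fun F : Finset ι => (∑ i ∈ F, u i) ^ p) atTop (𝓝 ((∑' i, u i) ^ p)) :=
    ((ENNReal.continuous_rpow_const (y := p)).tendsto _).comp ENNReal.summable.hasSum
  exact le_of_tendsto' hlim fun F => (hfin F).trans (ENNReal.sum_le_tsum F)

lemma one_le_rpow_neg_mul {d R Z : ℝ≥0∞} {p : ℝ} (hp : 0 < p) (hd : d < R) (hR : R ^ p ≤ Z) :
    1 ≤ d ^ (-p) * Z := by
  have hR0 : 0 < R ^ p := ENNReal.rpow_pos_of_nonneg (bot_le.trans_lt hd) hp.le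
  have hZ : Z ≠ 0 := (hR0.trans_le hR).ne'
  rcases eq_or_ne d 0 with rfl | h0
  · rw [ENNReal.zero_rpow_of_neg (neg_lt_zero.2 hp), ENNReal.top_mul hZ]
    exact le_top
  · calc (1 : ℝ≥0∞) = d ^ (-p) * d ^ p := by
          rw [← ENNReal.rpow_add _ _ h0 hd.ne_top]; simp
      _ ≤ d ^ (-p) * Z := by
          gcongr
          exact (ENNReal.rpow_le_rpow hd.le hp.le).trans hR

lemma tsum_offDiag_eq {E : Type*} (φ : Set E) (F : E × E → ℝ≥0∞) :
    ∑' p : φ.offDiag, F p = ∑' x : φ, ∑' y : φ, ({(x : E)} : Set E)ᶜ.indicator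
      (fun y => F (x, y)) y := by
  rw [tsum_subtype φ.offDiag F, ENNReal.tsum_prod', tsum_subtype φ fun x =>
    ∑' y : φ, ({x} : Set E)ᶜ.indicator (fun y => F (x, y)) y]
  congr 1
  ext x
  by_cases hx : x ∈ φ
  · rw [Set.indicator_of_mem hx, tsum_subtype φ (({x} : Set E)ᶜ.indicator fun y => F (x, y))]
    congr 1
    ext y
    rw [Set.indicator_indicator]
    by_cases hy : y ∈ φ <;> by_cases hxy : x = y <;> simp [Set.indicator, hx, hy, hxy, eq_comm]
  · simp [Set.indicator, hx]

/-- The weight of a single strong point in the pair interaction that dominates exceedance. -/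
def singleWeight (f g : Plane → ℝ≥0∞) (s t : ℝ≥0∞) (p : ℝ) : Plane → ℝ≥0∞ :=
  {x | s / 2 ≤ f x}.indicator fun x =>
    {x | f x ≤ s}.indicator (fun x => (s - f x) ^ (-p)) x +
    {x | g x ≤ t}.indicator (fun x => (t - g x) ^ (-p)) x

/-- A pair interaction that dominates exceedance when no single point exceeds both thresholds. -/
def pairKernel (f g : Plane → ℝ≥0∞) (s t : ℝ≥0∞) (p : ℝ) (z : Plane × Plane) : ℝ≥0∞ :=
  singleWeight f g s t p z.1 * (f z.2 ^ p + g z.2 ^ p) + (s * (s / 2))⁻¹ * (f z.1 * f z.2)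

variable {f g : Plane → ℝ≥0∞} {s t : ℝ≥0∞} {p : ℝ}

/-- If some point has `f x ≥ s / 2`, at least one of its two signals is below threshold. The other
points supply that deficit, and subadditivity of the `p`-th power turns this into the first term of
the kernel. If no point is strong, deleting any one leaves at least `s / 2` of the `f`-sum, so the
products `f x * f y` over distinct pairs add up to at least `s * (s / 2)`. -/
lemma one_le_tsum_pairKernel (hp : 0 < p) (hp1 : p ≤ 1) (hs : s ≠ 0) (hs' : s ≠ ∞)
    (h : ∀ x, f x ≤ s ∨ g x ≤ t) {φ : Set Plane} (hφ : φ ∈ exceedance f g s t) :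
    1 ≤ ∑' z : φ.offDiag, pairKernel f g s t p z := by
  have hdec : ∀ x ∈ φ, ∀ u : Plane → ℝ≥0∞,
      ∑' y : φ, u y = u x + ∑' y : φ, ({x} : Set Plane)ᶜ.indicator u y := by
    intro x hx u
    simpa using tsum_eq_finset_sum_add_tsum_indicator φ {x} {x} (by simp [hx]) u
  by_cases hex : ∃ x ∈ φ, s / 2 ≤ f x
  · obtain ⟨x, hx, hxs⟩ := hex
    -- Stated for a generic signal `u` with threshold `c`, to be used with whichever of `f`, `g`
    -- fails to exceed at `x`.
    have key : ∀ (u : Plane → ℝ≥0∞) (c : ℝ≥0∞), u x ≤ c → c < ∑' y : φ, u y →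
        (∀ y, (c - u x) ^ (-p) * u y ^ p ≤ pairKernel f g s t p (x, y)) →
        1 ≤ ∑' z : φ.offDiag, pairKernel f g s t p z := by
      intro u c huc hc hk
      refine le_trans ?_ (tsum_indicator_le_tsum_offDiag hx (Set.mem_singleton x)
        (fun y => (c - u x) ^ (-p) * u y ^ p) _ fun y _ => hk y)
      have h1 : ∀ y : φ, ({x} : Set Plane)ᶜ.indicator (fun y => (c - u x) ^ (-p) * u y ^ p) y =
          (c - u x) ^ (-p) * ({x} : Set Plane)ᶜ.indicator u y ^ p := by
        intro y
        by_cases hy : (y : Plane) ∈ ({x} : Set Plane)ᶜ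
        · simp only [Set.indicator_of_mem hy]
        · simp only [Set.indicator_of_notMem hy, ENNReal.zero_rpow_of_pos hp, mul_zero]
      simp_rw [h1]
      rw [ENNReal.tsum_mul_left]
      refine one_le_rpow_neg_mul hp ?_ (rpow_tsum_le_tsum_rpow _ hp hp1)
      refine ENNReal.sub_lt_of_lt_add huc ?_
      rw [add_comm, ← hdec x hx u]
      exact hc
    have hmem : x ∈ {x | s / 2 ≤ f x} := hxs
    rcases h x with hfx | hgx
    · refine key f s hfx hφ.1 fun y => ?_
      have hm : x ∈ {x | f x ≤ s} := hfx
      simp only [pairKernel, singleWeight, Set.indicator_of_mem hmem, Set.indicator_of_mem hm]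
      exact le_add_right (mul_le_mul' le_self_add le_self_add)
    · refine key g t hgx hφ.2 fun y => ?_
      have hm : x ∈ {x | g x ≤ t} := hgx
      simp only [pairKernel, singleWeight, Set.indicator_of_mem hmem, Set.indicator_of_mem hm]
      exact le_add_right (mul_le_mul' le_add_self le_add_self)
  · push Not at hex
    have h2 : s / 2 ≠ 0 := (ENNReal.half_pos hs).ne'
    have h2' : s / 2 ≠ ∞ := (ENNReal.half_lt_self hs hs').ne_top
    calc (1 : ℝ≥0∞) = (s * (s / 2))⁻¹ * (s * (s / 2)) :=
          (ENNReal.inv_mul_cancel (mul_ne_zero hs h2) (ENNReal.mul_ne_top hs' h2')).symm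
      _ ≤ (s * (s / 2))⁻¹ * ((∑' x : φ, f x) * (s / 2)) := by gcongr; exact hφ.1.le
      _ ≤ (s * (s / 2))⁻¹ * ∑' x : φ, ∑' y : φ, ({(x : Plane)} : Set Plane)ᶜ.indicator
            (fun y => f x * f y) y := by
          rw [← ENNReal.tsum_mul_right]
          gcongr with x
          have h1 : ∀ y : φ, ({(x : Plane)} : Set Plane)ᶜ.indicator (fun y => f x * f y) y =
              f x * ({(x : Plane)} : Set Plane)ᶜ.indicator f y := by
            intro y
            by_cases hy : (y : Plane) ∈ ({(x : Plane)} : Set Plane)ᶜ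
            · simp only [Set.indicator_of_mem hy]
            · simp only [Set.indicator_of_notMem hy, mul_zero]
          simp_rw [h1]
          rw [ENNReal.tsum_mul_left]
          gcongr
          by_contra hlt
          push Not at hlt
          have := ENNReal.add_lt_add (hex x x.2) hlt
          rw [← hdec x x.2 f, ENNReal.add_halves] at this
          exact absurd hφ.1 (not_lt.2 this.le)
      _ = ∑' z : φ.offDiag, (s * (s / 2))⁻¹ * (f z.1.1 * f z.1.2) := by
          rw [ENNReal.tsum_mul_left, tsum_offDiag_eq φ fun z => f z.1 * f z.2]
      _ ≤ _ := ENNReal.tsum_le_tsum fun z => le_add_self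

lemma measurable_singleWeight (hf : Measurable f) (hg : Measurable g) :
    Measurable (singleWeight f g s t p) := by
  have hw : ∀ {u : Plane → ℝ≥0∞} (c : ℝ≥0∞), Measurable u →
      Measurable ({x | u x ≤ c}.indicator fun x => (c - u x) ^ (-p)) := fun c hu =>
    ((measurable_const.sub hu).pow_const _).indicator (measurableSet_le hu measurable_const)
  exact ((hw s hf).add (hw t hg)).indicator (measurableSet_le measurable_const hf)

lemma measurable_pairKernel (hf : Measurable f) (hg : Measurable g) :
    Measurable (pairKernel f g s t p) :=
  (((measurable_singleWeight hf hg).comp measurable_fst).mul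
    (((hf.comp measurable_snd).pow_const p).add ((hg.comp measurable_snd).pow_const p))).add
    (((hf.comp measurable_fst).mul (hf.comp measurable_snd)).const_mul _)

lemma lintegral_pairKernel_ne_top (hf : Measurable f) (hg : Measurable g) (hs : s ≠ 0)
    (hfi : ∫⁻ x, f x ≠ ∞) (hfp : ∫⁻ x, f x ^ p ≠ ∞) (hgp : ∫⁻ x, g x ^ p ≠ ∞)
    (hw : ∫⁻ x, singleWeight f g s t p x ≠ ∞) :
    ∫⁻ z, pairKernel f g s t p z ≠ ∞ := by
  have hm := measurable_singleWeight (s := s) (t := t) (p := p) hf hg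
  have hmp : Measurable fun y => f y ^ p + g y ^ p := (hf.pow_const p).add (hg.pow_const p)
  have hmul : Measurable fun z : Plane × Plane =>
      singleWeight f g s t p z.1 * (f z.2 ^ p + g z.2 ^ p) :=
    (hm.comp measurable_fst).mul (hmp.comp measurable_snd)
  have hmul' : Measurable fun z : Plane × Plane => f z.1 * f z.2 :=
    (hf.comp measurable_fst).mul (hf.comp measurable_snd)
  simp only [pairKernel]
  rw [lintegral_add_left hmul,
    lintegral_const_mul _ hmul',
    Measure.volume_eq_prod, lintegral_prod_mul hm.aemeasurable hmp.aemeasurable,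
    lintegral_prod_mul hf.aemeasurable hf.aemeasurable, lintegral_add_left (hf.pow_const p)]
  refine ENNReal.add_ne_top.2 ⟨ENNReal.mul_ne_top hw (ENNReal.add_ne_top.2 ⟨hfp, hgp⟩),
    ENNReal.mul_ne_top (ENNReal.inv_ne_top.2 ?_) (ENNReal.mul_ne_top hfi hfi)⟩
  exact mul_ne_zero hs (ENNReal.half_pos hs).ne'

end Kernel

/-! ### Integrability estimates for the path loss -/

section PathLoss

variable {α : ℝ}

lemma pathLoss_pos {r : ℝ} (hr : 0 ≤ r) : 0 < pathLoss α r := by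
  have := Real.rpow_nonneg hr α
  unfold pathLoss
  positivity

lemma strictAntiOn_pathLoss (hα : 0 < α) : StrictAntiOn (pathLoss α) (Set.Ici 0) := by
  intro a ha b hb hab
  have h1 := Real.rpow_nonneg ha α
  have h2 := Real.rpow_lt_rpow ha hab hα
  unfold pathLoss
  gcongr

/-- The signal received at `z` from a transmitter at `x`. -/
def receivedPower (α : ℝ) (z x : Plane) : ℝ≥0∞ := ENNReal.ofReal (pathLoss α ‖x - z‖)

lemma measurable_receivedPower (α : ℝ) (z : Plane) : Measurable (receivedPower α z) := by
  unfold receivedPower pathLoss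
  fun_prop

lemma volume_receivedPower_eq (hα : 0 < α) (z : Plane) (c : ℝ≥0∞) :
    volume {x | receivedPower α z x = c} = 0 := by
  rcases Set.eq_empty_or_nonempty {x | receivedPower α z x = c} with h | ⟨x₀, hx₀⟩
  · rw [h, measure_empty]
  · refine measure_mono_null (fun x hx => ?_) (Measure.addHaar_sphere volume z ‖x₀ - z‖)
    rw [mem_sphere_iff_norm]
    have h1 : receivedPower α z x = receivedPower α z x₀ := hx.trans hx₀.symm
    have h2 := (ENNReal.ofReal_eq_ofReal_iff (pathLoss_pos (norm_nonneg _)).le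
      (pathLoss_pos (norm_nonneg _)).le).1 h1
    exact (strictAntiOn_pathLoss hα).injOn (norm_nonneg _) (norm_nonneg _) h2

lemma pathLoss_le_one_add_rpow (hα : 0 < α) {r : ℝ} (hr : 0 ≤ r) :
    pathLoss α r ≤ 2 ^ α * (1 + r) ^ (-α) := by
  have h0 := Real.rpow_nonneg hr α
  have h1 : (1 + r) ^ α ≤ 2 ^ α * (1 + r ^ α) := by
    rcases le_total r 1 with h | h
    · calc (1 + r) ^ α ≤ 2 ^ α := by gcongr; linarith
        _ ≤ 2 ^ α * (1 + r ^ α) := by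
          refine le_mul_of_one_le_right (by positivity) (by linarith)
    · calc (1 + r) ^ α ≤ (2 * r) ^ α := by gcongr; linarith
        _ = 2 ^ α * r ^ α := Real.mul_rpow (by norm_num) hr
        _ ≤ 2 ^ α * (1 + r ^ α) := by gcongr; linarith
  unfold pathLoss
  rw [Real.rpow_neg (by linarith), ← div_eq_mul_inv, inv_eq_one_div,
    div_le_div_iff₀ (by positivity) (by positivity)]
  linarith

lemma lintegral_receivedPower_rpow_ne_top {p : ℝ} (hα : 0 < α) (hp : 0 < p) (hαp : 2 < α * p)
    (z : Plane) : ∫⁻ x, receivedPower α z x ^ p ≠ ∞ := by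
  have hint : Integrable fun x : Plane => (1 + ‖x‖) ^ (-(α * p)) :=
    integrable_one_add_norm (by simpa using hαp)
  have hint2 := ((hint.comp_sub_right z).const_mul (((2 : ℝ) ^ α) ^ p)).lintegral_lt_top
  refine (lt_of_le_of_lt (lintegral_mono fun x => ?_) hint2).ne
  have hℓ := pathLoss_pos (α := α) (norm_nonneg (x - z))
  rw [receivedPower, ENNReal.ofReal_rpow_of_pos hℓ]
  refine ENNReal.ofReal_le_ofReal ?_
  have h1 : (0 : ℝ) ≤ 1 + ‖x - z‖ := by positivity
  calc pathLoss α ‖x - z‖ ^ p ≤ (2 ^ α * (1 + ‖x - z‖) ^ (-α)) ^ p := by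
        gcongr
        exact pathLoss_le_one_add_rpow hα (norm_nonneg _)
    _ = _ := by
        rw [Real.mul_rpow (by positivity) (by positivity), ← Real.rpow_mul h1, neg_mul]

lemma lintegral_receivedPower_ne_top (hα : 2 < α) (z : Plane) :
    ∫⁻ x, receivedPower α z x ≠ ∞ := by
  simpa using lintegral_receivedPower_rpow_ne_top (p := 1) (by linarith) one_pos (by linarith) z

/-- In polar coordinates this is the integral of `r * (r - ρ) ^ (-p)` over a bounded interval,
finite since `p < 1`. -/
lemma integrable_indicator_norm_sub_rpow {ρ M p : ℝ} (hρM : ρ ≤ M) (hp : p < 1) :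
    Integrable fun x : Plane => (Set.Ioo ρ M).indicator (fun r => (r - ρ) ^ (-p)) ‖x‖ := by
  rw [integrable_fun_norm_addHaar volume
    (f := (Set.Ioo ρ M).indicator fun r => (r - ρ) ^ (-p))]
  have h1 : IntervalIntegrable (fun r : ℝ => (r - ρ) ^ (-p)) volume ρ M := by
    have := (intervalIntegral.intervalIntegrable_rpow' (a := 0) (b := M - ρ)
      (show -1 < -p by linarith)).comp_sub_right ρ
    simpa using this
  have h2 := h1.continuousOn_mul (g := fun r : ℝ => r) (by fun_prop)
  rw [intervalIntegrable_iff_integrableOn_Ioo_of_le hρM] at h2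
  have h3 : Integrable ((Set.Ioo ρ M).indicator fun r : ℝ => r * (r - ρ) ^ (-p)) :=
    (integrable_indicator_iff measurableSet_Ioo).2 h2
  refine h3.integrableOn.congr_fun (fun r _ => ?_) measurableSet_Ioi
  by_cases hr : r ∈ Set.Ioo ρ M <;> simp [hr]

/-- The deficit vanishes no faster than linearly at the circle of radius `ρ`; the slope is positive
because `ρ > 0`. It follows from `r ^ α - ρ ^ α ≥ ρ ^ (α - 1) * (r - ρ)`. -/
lemma mul_sub_le_pathLoss_sub (hα : 1 < α) {ρ M r : ℝ} (hρ : 0 < ρ) (hr : ρ ≤ r) (hrM : r ≤ M) :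
    ρ ^ (α - 1) / ((1 + ρ ^ α) * (1 + M ^ α)) * (r - ρ) ≤ pathLoss α ρ - pathLoss α r := by
  have hr0 : 0 < r := hρ.trans_le hr
  have e : ∀ x : ℝ, 0 < x → x ^ α = x ^ (α - 1) * x := fun x hx => by
    rw [Real.rpow_sub_one hx.ne', div_mul_cancel₀ _ hx.ne']
  have h1 : ρ ^ (α - 1) * (r - ρ) ≤ r ^ α - ρ ^ α := by
    have : ρ ^ (α - 1) ≤ r ^ (α - 1) := Real.rpow_le_rpow hρ.le hr (by linarith)
    rw [e r hr0, e ρ hρ]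
    nlinarith
  have h2 : (0 : ℝ) < 1 + ρ ^ α := by positivity
  have h3 : (0 : ℝ) < 1 + r ^ α := by positivity
  have h4 : r ^ α ≤ M ^ α := Real.rpow_le_rpow hr0.le hrM (by linarith)
  have h5 : pathLoss α ρ - pathLoss α r = (r ^ α - ρ ^ α) / ((1 + ρ ^ α) * (1 + r ^ α)) := by
    unfold pathLoss
    field_simp
    ring
  rw [h5, div_mul_eq_mul_div]
  have h6 : (0 : ℝ) ≤ ρ ^ (α - 1) * (r - ρ) := mul_nonneg (by positivity) (by linarith)
  gcongr
  exact h6.trans h1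

lemma setLIntegral_ball_rpow_neg_ne_top (hα : 1 < α) {ρ p : ℝ} (hρ : 0 < ρ) (hp : 0 < p)
    (hp1 : p < 1) (z z' : Plane) (M : ℝ) :
    ∫⁻ x in Metric.ball z' M, {x | receivedPower α z x ≤ ENNReal.ofReal (pathLoss α ρ)}.indicator
      (fun x => (ENNReal.ofReal (pathLoss α ρ) - receivedPower α z x) ^ (-p)) x ≠ ∞ := by
  -- `N` is chosen so that the ball around `z'` lies in the ball of radius `N` around `z`, with `ρ <
  -- N` strictly.
  set N := max ρ (M + dist z' z) + 1
  have hρN : ρ < N := (le_max_left _ _).trans_lt (lt_add_one _)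
  set c := ρ ^ (α - 1) / ((1 + ρ ^ α) * (1 + N ^ α)) with hc
  have hN : 0 < N := hρ.trans hρN
  have hcpos : 0 < c := by positivity
  have hint := (((integrable_indicator_norm_sub_rpow hρN.le hp1).comp_sub_right z).const_mul
    (c ^ (-p))).lintegral_lt_top
  refine (lt_of_le_of_lt ?_ hint).ne
  rw [← lintegral_indicator measurableSet_ball]
  -- On the circle itself the deficit is 0 and its power is infinite, but the circle is null.
  have hsph : ∀ᵐ x : Plane, x ∉ Metric.sphere z ρ :=
    measure_eq_zero_iff_ae_notMem.1 (Measure.addHaar_sphere volume z ρ)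
  refine lintegral_mono_ae ?_
  filter_upwards [hsph] with x hx
  rw [mem_sphere_iff_norm] at hx
  by_cases hxM : x ∈ Metric.ball z' M
  swap
  · simp [Set.indicator_of_notMem hxM]
  rw [Set.indicator_of_mem hxM]
  by_cases hxs : receivedPower α z x ≤ ENNReal.ofReal (pathLoss α ρ)
  swap
  · rw [Set.indicator_of_notMem (by exact hxs)]
    exact bot_le
  rw [Set.indicator_of_mem (by exact hxs)]
  have hle : pathLoss α ‖x - z‖ ≤ pathLoss α ρ :=
    (ENNReal.ofReal_le_ofReal_iff (pathLoss_pos hρ.le).le).1 hxs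
  have hr : ρ < ‖x - z‖ := lt_of_le_of_ne
    (((strictAntiOn_pathLoss (by linarith)).le_iff_ge (norm_nonneg _) hρ.le).1 hle)
    (Ne.symm hx)
  have hrN : ‖x - z‖ < N := by
    rw [← dist_eq_norm]
    have h1 := dist_triangle x z' z
    have h2 : dist x z' < M := hxM
    have h3 : M + dist z' z ≤ max ρ (M + dist z' z) := le_max_right _ _
    have h4 : N = max ρ (M + dist z' z) + 1 := rfl
    linarith
  have hmem : ‖x - z‖ ∈ Set.Ioo ρ N := ⟨hr, hrN⟩
  rw [Set.indicator_of_mem hmem]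
  have hlow := mul_sub_le_pathLoss_sub hα hρ hr.le hrN.le
  rw [← hc] at hlow
  have hpos : 0 < c * (‖x - z‖ - ρ) := mul_pos hcpos (by linarith)
  rw [receivedPower, ← ENNReal.ofReal_sub _ (pathLoss_pos (norm_nonneg _)).le,
    ENNReal.ofReal_rpow_of_pos (hpos.trans_le hlow)]
  refine ENNReal.ofReal_le_ofReal ?_
  rw [← Real.mul_rpow hcpos.le (by linarith)]
  exact Real.rpow_le_rpow_of_nonpos hpos hlow (by linarith)

lemma exists_receivedPower_superlevel_subset_ball (hα : 0 < α) (z : Plane) {c : ℝ} (hc : 0 < c) :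
    ∃ M, {x | ENNReal.ofReal c ≤ receivedPower α z x} ⊆ Metric.ball z M := by
  refine ⟨(c⁻¹) ^ α⁻¹, fun x hx => ?_⟩
  have hx' : c ≤ pathLoss α ‖x - z‖ :=
    (ENNReal.ofReal_le_ofReal_iff (pathLoss_pos (norm_nonneg _)).le).1 hx
  rw [mem_ball_iff_norm]
  have h1 : (0 : ℝ) ≤ ‖x - z‖ ^ α := Real.rpow_nonneg (norm_nonneg _) _
  have h2 : 1 + ‖x - z‖ ^ α ≤ c⁻¹ := by
    rw [pathLoss] at hx'
    exact (le_inv_comm₀ hc (by positivity)).1 hx'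
  rw [← Real.rpow_lt_rpow_iff (norm_nonneg _) (by positivity) hα,
    ← Real.rpow_mul (by positivity), inv_mul_cancel₀ hα.ne', Real.rpow_one]
  linarith

/-- The condition `s / 2 ≤ f x` confines the weight to a bounded ball, so only the singularities at
the two circles matter. -/
lemma lintegral_singleWeight_receivedPower_ne_top (hα : 1 < α) {r₁ r₂ p : ℝ} (hr₁ : 0 < r₁)
    (hr₂ : 0 < r₂) (hp : 0 < p) (hp1 : p < 1) (z z' : Plane) :
    ∫⁻ x, singleWeight (receivedPower α z) (receivedPower α z') (ENNReal.ofReal (pathLoss α r₁))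
      (ENNReal.ofReal (pathLoss α r₂)) p x ≠ ∞ := by
  have hpos := pathLoss_pos (α := α) hr₁.le
  obtain ⟨M, hM⟩ := exists_receivedPower_superlevel_subset_ball (α := α) (by linarith) z
    (half_pos hpos)
  have hm1 := measurable_receivedPower α z
  have hmeas : Measurable ({x | receivedPower α z x ≤ ENNReal.ofReal (pathLoss α r₁)}.indicator
      (fun x => (ENNReal.ofReal (pathLoss α r₁) - receivedPower α z x) ^ (-p))) :=
    ((measurable_const.sub hm1).pow_const _).indicator (measurableSet_le hm1 measurable_const)
  have hhalf : ENNReal.ofReal (pathLoss α r₁) / 2 = ENNReal.ofReal (pathLoss α r₁ / 2) := by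
    rw [ENNReal.ofReal_div_of_pos two_pos]; simp
  unfold singleWeight
  rw [lintegral_indicator (measurableSet_le measurable_const hm1), hhalf]
  refine ((lintegral_mono_set hM).trans_lt ?_).ne
  rw [lintegral_add_left hmeas]
  exact ENNReal.add_lt_top.2
    ⟨(setLIntegral_ball_rpow_neg_ne_top hα hr₁ hp hp1 z z M).lt_top,
      (setLIntegral_ball_rpow_neg_ne_top hα hr₂ hp hp1 z' z M).lt_top⟩

end PathLoss

/-! ### From signal-to-interference ratios to exceedance, and from scaling to exponents -/

lemma ofReal_div_lt_ofReal_iff {A β : ℝ} (hA : 0 < A) (hβ : 0 < β) (I : ℝ≥0∞) :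
    ENNReal.ofReal A / I < ENNReal.ofReal β ↔ ENNReal.ofReal (A / β) < I := by
  have hβ0 : ENNReal.ofReal β ≠ 0 := (ENNReal.ofReal_pos.2 hβ).ne'
  rw [ENNReal.div_lt_iff (Or.inr (ENNReal.ofReal_pos.2 hA).ne') (Or.inr ENNReal.ofReal_ne_top),
    ENNReal.ofReal_div_of_pos hβ, ENNReal.div_lt_iff (Or.inl hβ0) (Or.inl ENNReal.ofReal_ne_top),
    mul_comm]

lemma pathLoss_rpow_one_div {α y : ℝ} (hα : 0 < α) (hy : 0 < y - 1) :
    pathLoss α ((y - 1) ^ (1 / α)) = y⁻¹ := by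
  rw [pathLoss, ← Real.rpow_mul hy.le, one_div_mul_cancel hα.ne', Real.rpow_one,
    add_sub_cancel]

lemma ofReal_pathLoss_lt_receivedPower_iff {α r : ℝ} (hα : 0 < α) (hr : 0 ≤ r) (z x : Plane) :
    ENNReal.ofReal (pathLoss α r) < receivedPower α z x ↔ x ∈ Metric.ball z r := by
  rw [receivedPower, ENNReal.ofReal_lt_ofReal_iff (pathLoss_pos (norm_nonneg _)),
    (strictAntiOn_pathLoss hα).lt_iff_gt hr (norm_nonneg _), mem_ball_iff_norm]

/-- `log q` equals `k * log l` plus a convergent term, and `log l` tends to `-∞`. -/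
lemma hasSCDO_of_tendsto {q : ℝ → ℝ} {k : ℕ} {c C : ℝ} (hc : 0 < c) (hC : 0 < C)
    (h : Tendsto (fun l => q l / (l ^ k * C)) (𝓝[>] 0) (𝓝 c)) : HasSCDO q k := by
  have h1 : Tendsto (fun l => Real.log (q l / (l ^ k * C)) + Real.log C) (𝓝[>] 0)
      (𝓝 (Real.log c + Real.log C)) := (h.log hc.ne').add_const _
  have h2 : Tendsto (fun l => (Real.log (q l / (l ^ k * C)) + Real.log C) / Real.log l + k)
      (𝓝[>] 0) (𝓝 (0 + k)) :=
    (h1.div_atBot Real.tendsto_log_nhdsGT_zero).add_const _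
  rw [zero_add] at h2
  refine h2.congr' ?_
  filter_upwards [h.eventually_const_lt hc, Ioo_mem_nhdsGT (zero_lt_one (α := ℝ))] with l hl hl1
  have hlk : 0 < l ^ k * C := mul_pos (pow_pos hl1.1 k) hC
  have hq : q l = q l / (l ^ k * C) * (l ^ k * C) := (div_mul_cancel₀ _ hlk.ne').symm
  have hlog : Real.log l ≠ 0 := (Real.log_neg hl1.1 hl1.2).ne
  have h3 : Real.log (q l) = Real.log (q l / (l ^ k * C)) + (k * Real.log l + Real.log C) := by
    conv_lhs => rw [hq]
    rw [Real.log_mul hl.ne' hlk.ne', Real.log_mul (pow_pos hl1.1 k).ne' hC.ne', Real.log_pow]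
  rw [h3]
  field_simp
  ring

lemma tendsto_toReal_div {Q : ℝ → ℝ≥0∞} {V : ℝ≥0∞} (k : ℕ) (hV : V ≠ ∞) (C : ℝ)
    (h : Tendsto (fun l => Q l / ENNReal.ofReal l ^ k) (𝓝[>] 0) (𝓝 V)) :
    Tendsto (fun l => (Q l).toReal / (l ^ k * C)) (𝓝[>] 0) (𝓝 (V.toReal / C)) := by
  refine (((ENNReal.tendsto_toReal hV).comp h).div_const C).congr' ?_
  filter_upwards [self_mem_nhdsWithin] with l hl
  have hl' : 0 ≤ l := le_of_lt hl
  simp only [Function.comp_apply, ENNReal.toReal_div, ENNReal.toReal_pow,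
    ENNReal.toReal_ofReal hl']
  rw [div_div]

end SpatialContention

end

/-! ### The diversity order in the broadcast phase -/

open SpatialContention in
theorem theorem3 {Ω : ℝ → Type*} [∀ l, MeasurableSpace (Ω l)] (P : ∀ l, Measure (Ω l))
    (Φ : ∀ l, Ω l → Set Plane) (hΦ : ∀ l, 0 < l → IsStationaryPPP (P l) (Φ l) l)
    (α β : ℝ) (hα : 2 < α) (xs xr xd : Plane)
    (hr : 0 < β * (pathLoss α ‖xs - xr‖)⁻¹ - 1)
    (hd : 0 < 1 / 2 * β * (pathLoss α ‖xs - xd‖)⁻¹ - 1) :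
    let r₁ : ℝ := radiusR α β xs xr
    let r₂ : ℝ := radiusD α β xs xd
    let Ar : Set Plane := Metric.ball xr r₁
    let Ad : Set Plane := Metric.ball xd r₂
    let q : ℝ → ℝ := fun l => qBC (P l) (Φ l) α β xs xr xd
    ((Ar ∩ Ad).Nonempty → ScalesLike q (fun l => l * volume.real (Ar ∩ Ad))) ∧
    (Ar ∩ Ad = ∅ → ScalesLike q (fun l => l ^ 2 * volume.real Ar * volume.real Ad)) ∧
    (‖xr - xd‖ < r₁ + r₂ → HasSCDO q 1) ∧
    (r₁ + r₂ ≤ ‖xr - xd‖ → HasSCDO q 2) := by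
  intro r₁ r₂ Ar Ad q
  have hα0 : 0 < α := by linarith
  have hℓr := pathLoss_pos (α := α) (norm_nonneg (xs - xr))
  have hℓd := pathLoss_pos (α := α) (norm_nonneg (xs - xd))
  have hβ : 0 < β := by
    by_contra hβ
    nlinarith [mul_nonneg (neg_nonneg.2 (not_lt.1 hβ)) (inv_pos.2 hℓr).le]
  have hr₁ : 0 < r₁ := Real.rpow_pos_of_pos hr _
  have hr₂ : 0 < r₂ := Real.rpow_pos_of_pos hd _
  set f := receivedPower α xr with hf_def
  set g := receivedPower α xd with hg_def
  set s := ENNReal.ofReal (pathLoss α r₁) with hs_def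
  set t := ENNReal.ofReal (pathLoss α r₂) with ht_def
  have hs : 0 < s := ENNReal.ofReal_pos.2 (pathLoss_pos hr₁.le)
  have hfs : ∀ x, s < f x ↔ x ∈ Ar := ofReal_pathLoss_lt_receivedPower_iff hα0 hr₁.le xr
  have hgt : ∀ x, t < g x ↔ x ∈ Ad := ofReal_pathLoss_lt_receivedPower_iff hα0 hr₂.le xd
  have hq : ∀ l, q l = (P l {ω | Φ l ω ∈ exceedance f g s t}).toReal := by
    intro l
    simp only [q, qBC, Measure.real]
    congr 2
    ext ω
    have e₁ : pathLoss α r₁ = pathLoss α ‖xs - xr‖ / β := by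
      refine (pathLoss_rpow_one_div hα0 hr).trans ?_
      rw [mul_inv, inv_inv, div_eq_inv_mul]
    have e₂ : pathLoss α r₂ = 2 * pathLoss α ‖xs - xd‖ / β := by
      refine (pathLoss_rpow_one_div hα0 hd).trans ?_
      field_simp
    have h₁ : sirSR α xs xr (Φ l ω) < ENNReal.ofReal β ↔ s < ∑' x : Φ l ω, f x := by
      rw [hs_def, e₁]
      exact ofReal_div_lt_ofReal_iff hℓr hβ _
    have h₂ : sirSD α xs xd (Φ l ω) < ENNReal.ofReal β ↔ t < ∑' x : Φ l ω, g x := by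
      rw [ht_def, e₂]
      exact ofReal_div_lt_ofReal_iff (by positivity) hβ _
    exact (and_congr h₂ h₁).trans and_comm
  have hf : Measurable f := measurable_receivedPower α xr
  have hg : Measurable g := measurable_receivedPower α xd
  have hfi : ∫⁻ x, f x ≠ ∞ := lintegral_receivedPower_ne_top hα xr
  have hgi : ∫⁻ x, g x ≠ ∞ := lintegral_receivedPower_ne_top hα xd
  have hfnull := volume_receivedPower_eq hα0 xr
  have hgnull := volume_receivedPower_eq hα0 xd
  have hArfin : volume Ar ≠ ∞ := measure_ball_lt_top.ne
  have hAdfin : volume Ad ≠ ∞ := measure_ball_lt_top.ne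
  have hArpos : 0 < volume Ar := Metric.measure_ball_pos _ _ hr₁
  have hAdpos : 0 < volume Ad := Metric.measure_ball_pos _ _ hr₂
  have first : (Ar ∩ Ad).Nonempty → 0 < volume.real (Ar ∩ Ad) ∧
      Tendsto (fun l => q l / (l ^ 1 * volume.real (Ar ∩ Ad))) (𝓝[>] 0) (𝓝 1) := by
    intro hne
    have hfin : volume (Ar ∩ Ad) ≠ ∞ := measure_ne_top_of_subset Set.inter_subset_left hArfin
    have hpos : 0 < volume.real (Ar ∩ Ad) := ENNReal.toReal_pos
      ((Metric.isOpen_ball.inter Metric.isOpen_ball).measure_pos volume hne).ne' hfin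
    refine ⟨hpos, ?_⟩
    have h1 := tendsto_measure_exceedance_div (t := t) hΦ hf hg hfi hgi hfnull hgnull hs
      ENNReal.ofReal_ne_top
    have h2 : {x | s < f x ∧ t < g x} = Ar ∩ Ad := by
      ext x
      exact and_congr (hfs x) (hgt x)
    rw [h2] at h1
    have h3 := tendsto_toReal_div 1 hfin (volume.real (Ar ∩ Ad)) (by simpa only [pow_one] using h1)
    rw [← Measure.real, div_self hpos.ne'] at h3
    simpa only [hq] using h3
  have second : Ar ∩ Ad = ∅ → ∃ c : ℝ, 0 < c ∧
      Tendsto (fun l => q l / (l ^ 2 * (volume.real Ar * volume.real Ad))) (𝓝[>] 0) (𝓝 c) := by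
    intro hempty
    have hor : ∀ x, f x ≤ s ∨ g x ≤ t := by
      intro x
      by_contra hx
      push Not at hx
      have : x ∈ Ar ∩ Ad := ⟨(hfs x).1 hx.1, (hgt x).1 hx.2⟩
      simp [hempty] at this
    -- The midpoint of the interval from `2 / α` to 1: above `2 / α` for integrability of `ℓ ^ p` at
    -- infinity, below 1 for integrability at the circles.
    set p : ℝ := (2 / α + 1) / 2 with hp_def
    have hp : 0 < p := by positivity
    have hp1 : p < 1 := by
      have : 2 / α < 1 := (div_lt_one hα0).2 hα
      linarith
    have hαp : 2 < α * p := by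
      have : α * p = (2 + α) / 2 := by rw [hp_def]; field_simp
      linarith
    obtain ⟨h1, h2⟩ := tendsto_measure_exceedance_div_sq (s := s) (t := t) hΦ hf hg
      (fun _ => ENNReal.ofReal_ne_top) (fun _ => ENNReal.ofReal_ne_top) hfi hgi hfnull hgnull
      (measurable_pairKernel hf hg)
      (lintegral_pairKernel_ne_top (p := p) (t := t) hf hg hs.ne' hfi
        (lintegral_receivedPower_rpow_ne_top hα0 hp hαp xr)
        (lintegral_receivedPower_rpow_ne_top hα0 hp hαp xd)
        (lintegral_singleWeight_receivedPower_ne_top (by linarith) hr₁ hr₂ hp hp1 xr xd))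
      (fun φ hφ => one_le_tsum_pairKernel hp hp1.le hs.ne' ENNReal.ofReal_ne_top hor hφ)
    set W := {z : Plane × Plane | s < f z.1 + f z.2 ∧ t < g z.1 + g z.2}
    -- One point in each disc suffices for joint exceedance. `W` may also hold pairs that exceed
    -- only together, so the constant is merely shown to be positive and finite.
    have hW : 0 < volume W := by
      have hsub : Ar ×ˢ Ad ⊆ W := fun z hz =>
        ⟨((hfs _).2 hz.1).trans_le le_self_add, ((hgt _).2 hz.2).trans_le le_add_self⟩
      refine lt_of_lt_of_le ?_ (measure_mono hsub)
      rw [Measure.volume_eq_prod, Measure.prod_prod]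
      exact ENNReal.mul_pos hArpos.ne' hAdpos.ne'
    have hW2 : volume W / 2 ≠ ∞ := (ENNReal.div_lt_top h2 two_ne_zero).ne
    have h3 := tendsto_toReal_div 2 hW2 (volume.real Ar * volume.real Ad) h1
    refine ⟨_, ?_, by simpa only [hq] using h3⟩
    exact div_pos (ENNReal.toReal_pos (ENNReal.half_pos hW.ne').ne' hW2)
      (mul_pos (ENNReal.toReal_pos hArpos.ne' hArfin) (ENNReal.toReal_pos hAdpos.ne' hAdfin))
  refine ⟨fun hne => ⟨1, one_pos, by simpa only [pow_one] using (first hne).2⟩, fun hempty => ?_,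
    fun hlt => ?_, fun hle => ?_⟩
  · simpa only [ScalesLike, mul_assoc] using second hempty
  · have hne : (Ar ∩ Ad).Nonempty := by
      rw [← Set.not_disjoint_iff_nonempty_inter, disjoint_ball_ball_iff hr₁ hr₂, dist_eq_norm]
      exact not_le.2 hlt
    simpa using hasSCDO_of_tendsto one_pos (first hne).1 (first hne).2
  · have hempty : Ar ∩ Ad = ∅ := by
      rw [← Set.disjoint_iff_inter_eq_empty, disjoint_ball_ball_iff hr₁ hr₂, dist_eq_norm]
      exact hle
    obtain ⟨c, hc, h⟩ := second hempty
    simpa using hasSCDO_of_tendsto hc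
      (mul_pos (ENNReal.toReal_pos hArpos.ne' hArfin) (ENNReal.toReal_pos hAdpos.ne' hAdfin)) h
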